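/- Let $K\subseteq\mathbb R^n$ be a nonempty closed convex set (not necessarily bounded), $d=\operatorname{diam}(K)\in[0,\infty]$, $\sigma>0$, and let $\|\cdot\|$ be the Euclidean norm. For $Y=\mu+\xi$ with $\mu\in K$ and $\xi\sim N(0,\sigma^2 I_n)$, let $\hat\mu(Y)=\operatorname{argmin}_{\nu\in K}\|Y-\nu\|$ be the least squares estimator, with worst case rate $\varepsilon_K(\sigma)=\big(\sup_{\mu\in K}\mathbb E\|\hat\mu(Y)-\mu\|^2\big)^{1/2}$. With $B(\mu,\varepsilon)$ the closed ball and $x\sim N(0,I_n)$, let $w_\mu(\varepsilon)=\mathbb E\sup_{t\in B(\mu,\varepsilon)\cap K}\langle x,t\rangle$ be the local Gaussian width. For a constant $c^*>2$ let $M^{\mathrm{loc}}(\varepsilon)$ be the supremum over $\theta\in K$ of the largest cardinality of a subset of $B(\theta,\varepsilon)\cap K$ whose distinct points have pairwise distances $>\varepsilon/c^*$. For $L>0$ and $C=1+2/c^*$ define $$\overline\varepsilon(\sigma)=\sup\Big\{\varepsilon>0:\ \exists\,\nu_1\neq\nu_2\in K,\ \ w_{\nu_1}(\varepsilon/c^*)-w_{\nu_2}(\varepsilon/c^*)-\frac{C\varepsilon\|\nu_1-\nu_2\|}{\sigma}+\frac{L}{c^*}\|\nu_1-\nu_2\|\sqrt{\log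 M^{\mathrm{loc}}(\varepsilon)}\ \ge 0\Big\}$$ (with $\sup\emptyset=0$), and let $\sigma'=4C\sigma/(1-4/{c^*}^2)$. Theorem. For every $c^*>2$ there is $L_0>0$, depending only on $c^*$, such that for every $L\ge L_0$ the following hold. (1) There is a constant $A>0$ such that $\varepsilon_K(\sigma)\le A\,\overline\varepsilon(\sigma')$ for all $n$, $K$, $\sigma$ as above. (2) There are constants $A,B>0$ such that, for all $n$, $K$, $\sigma$ as above, if $\overline\varepsilon(\sigma)\ge B\sigma$ then $\overline\varepsilon(\sigma)/c^*\le A\,\varepsilon_K(\sigma)$. (3) For every $D\ge 0$ there are constants $a,b>0$ such that, for all $n$, $K$, $\sigma$ as above, if $\overline\varepsilon(\sigma')\le D\sigma$ then $a\min(\sigma,d)\le\varepsilon_K(\sigma)\le b\min(\sigma,d)$. Here $A,B$ depend only on $c^*$ and $L$, and $a,b$ only on $c^*$, $L$ and $D$; none depends on $n$, $K$ or $\sigma$. -/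

import Mathlib

open MeasureTheory ProbabilityTheory
open scoped ENNReal NNReal

namespace LSE

/-- `ℝⁿ` with its Euclidean norm. -/
abbrev E (n : ℕ) : Type := EuclideanSpace ℝ (Fin n)

/-- `v` is a least squares fit of `y` in `K`: a point of `K` that minimizes `‖y - ν‖` over `ν ∈ K`. -/
def IsLeastSquares {n : ℕ} (K : Set (E n)) (y v : E n) : Prop :=
  v ∈ K ∧ ∀ ν ∈ K, ‖y - v‖ ≤ ‖y - ν‖

/-- The least squares estimator `Y ↦ argmin_{ν ∈ K} ‖Y - ν‖`. For a nonempty closed convex set the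
minimizer exists and is unique, see `isLeastSquares_iff`. -/
noncomputable def lse {n : ℕ} (K : Set (E n)) (y : E n) : E n :=
  Classical.epsilon (IsLeastSquares K y)

theorem isLeastSquares_iff {n : ℕ} {K : Set (E n)} (hne : K.Nonempty) (hcl : IsClosed K)
    (hcv : Convex ℝ K) (y v : E n) : IsLeastSquares K y v ↔ v = lse K y := by
  have hInf : ∀ v : E n, IsLeastSquares K y v → ‖y - v‖ = ⨅ w : K, ‖y - w‖ := by
    intro v hv
    have : Nonempty K := hne.to_subtype
    apply le_antisymm
    · exact le_ciInf fun w => hv.2 w w.2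
    · exact ciInf_le (f := fun w : K => ‖y - (w : E n)‖)
        ⟨0, by rintro _ ⟨w, rfl⟩; exact norm_nonneg _⟩ ⟨v, hv.1⟩
  have huniq : ∀ a b : E n, IsLeastSquares K y a → IsLeastSquares K y b → a = b := by
    intro a b ha hb
    have h1 := (norm_eq_iInf_iff_real_inner_le_zero hcv ha.1).1 (hInf a ha) b hb.1
    have h2 := (norm_eq_iInf_iff_real_inner_le_zero hcv hb.1).1 (hInf b hb) a ha.1
    have h3 : inner ℝ (a - b) (a - b) ≤ (0 : ℝ) := by
      have : inner ℝ (a - b) (a - b) = inner ℝ (y - a) (b - a) + inner ℝ (y - b) (a - b) := by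
        have e : b - a = -(a - b) := by abel
        have e2 : a - b = (y - b) - (y - a) := by abel
        rw [e, inner_neg_right]
        nth_rewrite 1 [e2]
        rw [inner_sub_left]
        ring
      linarith
    rw [real_inner_self_eq_norm_sq] at h3
    exact sub_eq_zero.1 (norm_eq_zero.1 (by nlinarith [norm_nonneg (a - b)]))
  have hex : ∃ v, IsLeastSquares K y v := by
    obtain ⟨v, hv, h⟩ := exists_norm_eq_iInf_of_complete_convex hne hcl.isComplete hcv y
    refine ⟨v, hv, fun ν hν => ?_⟩
    rw [h]
    exact ciInf_le (f := fun w : K => ‖y - (w : E n)‖)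
      ⟨0, by rintro _ ⟨w, rfl⟩; exact norm_nonneg _⟩ ⟨ν, hν⟩
  have hs : IsLeastSquares K y (lse K y) := Classical.epsilon_spec hex
  exact ⟨fun h => huniq _ _ h hs, fun h => h ▸ hs⟩

/-- The worst case rate of the least squares estimator, `ε_K(σ)`, given by
`ε_K(σ)² = sup_{μ ∈ K} 𝔼 ‖μ̂(Y) - μ‖²`, where `Y = μ + σ x` and `x ∼ N(0, I_n)`. -/
noncomputable def worstRate {n : ℕ} (K : Set (E n)) (σ : ℝ) : ℝ≥0∞ :=
  (⨆ μ ∈ K, ∫⁻ x, ‖lse K (μ + σ • x) - μ‖ₑ ^ 2 ∂(stdGaussian (E n))) ^ (1 / 2 : ℝ)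

/-- The Gaussian width `w(T) = 𝔼 sup_{t ∈ T} ⟨x, t⟩`, `x ∼ N(0, I_n)`, of a bounded nonempty set. -/
noncomputable def gaussianWidth {n : ℕ} (T : Set (E n)) : ℝ :=
  ∫ x, (⨆ t : T, inner ℝ x (t : E n)) ∂(stdGaussian (E n))

/-- The local Gaussian width `w_μ(ε) = w(B(μ, ε) ∩ K)`; balls are closed. -/
noncomputable def localWidth {n : ℕ} (K : Set (E n)) (μ : E n) (ε : ℝ) : ℝ :=
  gaussianWidth (Metric.closedBall μ ε ∩ K)

/-- `M^loc(ε)`: the supremum over `θ ∈ K` of the largest cardinality of a subset of `B(θ, ε) ∩ K`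
with pairwise distances `> ε / c`. It is finite, since `ℝⁿ` is finite-dimensional. -/
noncomputable def locPacking {n : ℕ} (K : Set (E n)) (c ε : ℝ) : ℕ∞ :=
  ⨆ θ ∈ K, Metric.packingNumber (ε / c).toNNReal (Metric.closedBall θ ε ∩ K)

/-- The local entropy `log M^loc(ε)`. -/
noncomputable def locEntropy {n : ℕ} (K : Set (E n)) (c ε : ℝ) : ℝ :=
  Real.log ((locPacking K c ε).toNat : ℝ)

/-- The radii `ε > 0` for which two distinct points `ν₁, ν₂ ∈ K` satisfy
`w_{ν₁}(ε/c) - w_{ν₂}(ε/c) - C ε ‖ν₁ - ν₂‖ / σ + (L/c) ‖ν₁ - ν₂‖ √(log M^loc(ε)) ≥ 0`,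
with `C = 1 + 2/c`. -/
def lipschitzRadii {n : ℕ} (K : Set (E n)) (c L σ : ℝ) : Set ℝ :=
  {ε | 0 < ε ∧ ∃ ν₁ ∈ K, ∃ ν₂ ∈ K, ν₁ ≠ ν₂ ∧
    0 ≤ localWidth K ν₁ (ε / c) - localWidth K ν₂ (ε / c)
      - (1 + 2 / c) * ε * ‖ν₁ - ν₂‖ / σ
      + L / c * ‖ν₁ - ν₂‖ * Real.sqrt (locEntropy K c ε)}

/-- `ε̄(σ)`, the supremum in `[0, ∞]` of the radii above (`0` if there are none). -/
noncomputable def lipschitzRate {n : ℕ} (K : Set (E n)) (c L σ : ℝ) : ℝ≥0∞ :=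
  ⨆ ε ∈ lipschitzRadii K c L σ, ENNReal.ofReal ε

/-- The rescaled noise level `σ' = 4 C σ / (1 - 4/c²)` with `C = 1 + 2/c`. -/
noncomputable def rescaledNoise (c σ : ℝ) : ℝ :=
  4 * (1 + 2 / c) * σ / (1 - 4 / c ^ 2)

end LSE

namespace LSE

/-! Any `L ≥ 7c` works. For `μ ∈ K` let `Z(s)` be the supremum of `⟨x, t - μ⟩` over `t ∈ B(μ, s) ∩
K`. Convexity of `K` makes `Z` concave, and the error of the least squares estimator maximizes `σ
Z(s) - s²/2` (`localSup_le_localSup_of_between`). Since `Z(s)` is sub-Gaussian around `w_μ(s)` at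
scale `s` (`hasSubgaussianMGF_localSup`), the size of the error can be read off from increments of
the local width.

Upper bound: if `s` is not a Lipschitz radius at noise `σ'`, then `ν ↦ w_ν(s/c)` has Lipschitz
constant `C s/σ' - (L/c) √(log M^loc(s))` on `K`. Covering `B(μ, s) ∩ K` by at most `M^loc(s)` balls
of radius `s/c` costs `7 s √(log M^loc(s))`, which `L/c ≥ 7` absorbs, so `w_μ(s) - w_μ(s/c) ≤ C
s²/σ'` (`localWidth_sub_le_of_notMem`). By the choice of `σ'` this growth is too slow for the error
to reach `s`, except with probability of order `σ⁴/s⁴`. Integration gives a bound by `ε̄(σ') + σ`,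
and the extra `σ` is removed by `min(σ, d) ≤ ε̄(σ')` together with `ε_K(σ) ≤ d`.

Lower bound: at a Lipschitz radius `ε` well above `σ`, either the entropy term makes up half of `C ε
‖ν₁ - ν₂‖/σ`, or the width difference does. In the first case a contracted local packing is
statistically indistinguishable (`le_worstRate_of_le_locEntropy`). In the second, concavity turns
the difference between two centres into radial growth at one of them, which forces a large error
there (`le_worstRate_of_le_localWidth_sub`). In the remaining regime, a two-point argument gives the
lower bound, and the upper bound combines the first part with `ε_K(σ) ≤ d`. -/

/-! ### Gaussian integrals, translations and null sets. -/

theorem integrable_exp_norm {n : ℕ} (a : ℝ) :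
    Integrable (fun x : E n => Real.exp (a * ‖x‖)) (stdGaussian (E n)) := by
  obtain ⟨C, hC, hint⟩ := IsGaussian.exists_integrable_exp_sq (stdGaussian (E n))
  refine (hint.const_mul (Real.exp (a ^ 2 / (4 * C)))).mono' (by fun_prop) (.of_forall fun x => ?_)
  rw [Real.norm_of_nonneg (Real.exp_pos _).le, ← Real.exp_add]
  refine Real.exp_le_exp.2 ?_
  have h : a ^ 2 / (4 * C) + C * ‖x‖ ^ 2 - a * ‖x‖ = (a - 2 * C * ‖x‖) ^ 2 / (4 * C) := by
    field_simp; ring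
  have : 0 ≤ (a - 2 * C * ‖x‖) ^ 2 / (4 * C) := by positivity
  linarith

theorem abs_le_of_lipschitz {n : ℕ} {f : E n → ℝ} {L : ℝ≥0} (hf : LipschitzWith L f) (x : E n) :
    |f x| ≤ |f 0| + L * ‖x‖ := by
  have h := hf.dist_le_mul x 0
  rw [dist_zero_right, Real.dist_eq] at h
  have := abs_sub_abs_le_abs_sub (f x) (f 0)
  linarith

theorem integrable_of_lipschitz {n : ℕ} {f : E n → ℝ} {L : ℝ≥0} (hf : LipschitzWith L f) :
    Integrable f (stdGaussian (E n)) := by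
  have hn : Integrable (fun x : E n => ‖x‖) (stdGaussian (E n)) :=
    (IsGaussian.integrable_id (μ := stdGaussian (E n))).norm
  refine ((integrable_const |f 0|).add (hn.const_mul L)).mono'
    hf.continuous.aestronglyMeasurable (.of_forall fun x => ?_)
  simpa using abs_le_of_lipschitz hf x

theorem integrable_exp_of_lipschitz {n : ℕ} {f : E n → ℝ} {L : ℝ≥0} (hf : LipschitzWith L f)
    (t : ℝ) : Integrable (fun x => Real.exp (t * f x)) (stdGaussian (E n)) := by
  have hc := hf.continuous
  refine ((integrable_exp_norm (|t| * L)).const_mul (Real.exp (|t| * |f 0|))).mono'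
    (by fun_prop) (.of_forall fun x => ?_)
  rw [Real.norm_of_nonneg (Real.exp_pos _).le, ← Real.exp_add]
  refine Real.exp_le_exp.2 ?_
  have h1 := mul_le_mul_of_nonneg_left (abs_le_of_lipschitz hf x) (abs_nonneg t)
  have h2 := le_abs_self (t * f x)
  rw [abs_mul] at h2
  linarith

theorem integral_exp_dual {n : ℕ} (ℓ : StrongDual ℝ (E n)) :
    ∫ x, Real.exp (ℓ x) ∂(stdGaussian (E n)) = Real.exp (‖ℓ‖ ^ 2 / 2) := by
  have h := IsGaussian.map_eq_gaussianReal (μ := stdGaussian (E n)) ℓ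
  rw [integral_strongDual_stdGaussian, variance_dual_stdGaussian] at h
  have h2 := mgf_gaussianReal h 1
  simp only [mgf, one_mul] at h2
  rw [h2]
  congr 1
  simp

theorem lintegral_exp_dual {n : ℕ} (ℓ : StrongDual ℝ (E n)) :
    ∫⁻ x, ENNReal.ofReal (Real.exp (ℓ x)) ∂(stdGaussian (E n))
      = ENNReal.ofReal (Real.exp (‖ℓ‖ ^ 2 / 2)) := by
  rw [← integral_exp_dual, ofReal_integral_eq_lintegral_ofReal]
  · simpa using integrable_exp_of_lipschitz ℓ.lipschitz 1
  · exact .of_forall fun x => (Real.exp_pos _).le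

/-- The integrand factors over coordinates, and each factor is the complex moment generating
function of `N(0, 1)` at `h i + t i * I`. Up to normalization this is the characteristic function of
the measure tilted by `h`. -/
theorem integral_cexp_inner {n : ℕ} (h t : E n) :
    ∫ x, Complex.exp (inner ℝ h x + inner ℝ x t * Complex.I) ∂(stdGaussian (E n))
      = Complex.exp (‖h‖ ^ 2 / 2 + inner ℝ h t * Complex.I - ‖t‖ ^ 2 / 2) := by
  rw [← map_pi_eq_stdGaussian, integral_map (by fun_prop) (by fun_prop)]
  have e : ∀ y : Fin n → ℝ, Complex.exp ((inner ℝ h (WithLp.toLp 2 y) : ℝ)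
      + (inner ℝ (WithLp.toLp 2 y) t : ℝ) * Complex.I)
      = ∏ i, Complex.exp ((h i + t i * Complex.I) * y i) := by
    intro y
    rw [← Complex.exp_sum]
    congr 1
    simp only [PiLp.inner_apply, Complex.ofReal_sum, Finset.sum_mul, ← Finset.sum_add_distrib]
    refine Finset.sum_congr rfl fun i _ => ?_
    simp
    ring
  simp_rw [e]
  rw [integral_fintype_prod_eq_prod (f := fun i (x : ℝ) =>
    Complex.exp ((h i + t i * Complex.I) * x))]
  have e2 : ∀ i, ∫ x : ℝ, Complex.exp ((h i + t i * Complex.I) * x) ∂(gaussianReal 0 1)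
      = Complex.exp ((h i + t i * Complex.I) ^ 2 / 2) := by
    intro i
    have := complexMGF_id_gaussianReal (μ := 0) (v := 1) (h i + t i * Complex.I)
    simpa [complexMGF] using this
  simp_rw [e2]
  rw [← Complex.exp_sum]
  congr 1
  rw [← Complex.ofReal_pow, ← Complex.ofReal_pow, EuclideanSpace.real_norm_sq_eq,
    EuclideanSpace.real_norm_sq_eq, PiLp.inner_apply]
  push_cast
  rw [Finset.sum_div, Finset.sum_div, Finset.sum_mul, ← Finset.sum_add_distrib,
    ← Finset.sum_sub_distrib]
  refine Finset.sum_congr rfl fun i _ => ?_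
  simp
  ring_nf
  simp
  ring

/-- The Cameron-Martin formula for the standard Gaussian measure. -/
theorem tilted_stdGaussian {n : ℕ} (h : E n) :
    (stdGaussian (E n)).tilted (fun x => inner ℝ h x) = (stdGaussian (E n)).map (fun x => x + h) := by
  have hint : Integrable (fun x : E n => Real.exp (inner ℝ h x)) (stdGaussian (E n)) := by
    simpa using integrable_exp_of_lipschitz (innerSL ℝ h).lipschitz 1
  have hexp : ∫ x : E n, Real.exp (inner ℝ h x) ∂(stdGaussian (E n)) = Real.exp (‖h‖ ^ 2 / 2) := by
    simpa using integral_exp_dual (innerSL ℝ h)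
  have := isProbabilityMeasure_tilted hint
  have : IsProbabilityMeasure ((stdGaussian (E n)).map (fun x => x + h)) :=
    Measure.isProbabilityMeasure_map (by fun_prop)
  refine Measure.ext_of_charFun (funext fun t => ?_)
  rw [charFun_apply, charFun_apply, integral_tilted, integral_map (by fun_prop) (by fun_prop), hexp]
  have e1 : ∀ x : E n, (Real.exp (inner ℝ h x) / Real.exp (‖h‖ ^ 2 / 2)) •
      Complex.exp (inner ℝ x t * Complex.I) = Complex.exp (-(‖h‖ ^ 2 / 2)) *
        Complex.exp (inner ℝ h x + inner ℝ x t * Complex.I) := by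
    intro x
    rw [← Real.exp_sub, Complex.real_smul, Complex.ofReal_exp, ← Complex.exp_add,
      ← Complex.exp_add]
    congr 1
    push_cast
    ring
  have e2 : ∀ x : E n, Complex.exp ((inner ℝ (x + h) t : ℝ) * Complex.I) =
      Complex.exp (inner ℝ h t * Complex.I) * Complex.exp (inner ℝ x t * Complex.I) := by
    intro x
    rw [← Complex.exp_add, inner_add_left]
    congr 1
    push_cast
    ring
  simp_rw [e1, e2]
  rw [integral_const_mul, integral_const_mul, ← charFun_apply, charFun_stdGaussian,
    integral_cexp_inner, ← Complex.exp_add, ← Complex.exp_add]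
  congr 1
  ring

theorem lintegral_add_right_stdGaussian {n : ℕ} (h : E n) {g : E n → ℝ≥0∞} (hg : Measurable g) :
    ∫⁻ x, g (x + h) ∂(stdGaussian (E n))
      = ∫⁻ x, ENNReal.ofReal (Real.exp (inner ℝ h x - ‖h‖ ^ 2 / 2)) * g x ∂(stdGaussian (E n)) := by
  have hexp : ∫ x : E n, Real.exp (inner ℝ h x) ∂(stdGaussian (E n)) = Real.exp (‖h‖ ^ 2 / 2) := by
    simpa using integral_exp_dual (innerSL ℝ h)
  rw [← lintegral_map hg (by fun_prop), ← tilted_stdGaussian, lintegral_tilted, hexp]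
  simp_rw [Real.exp_sub]

/-- Averaging over all shifts, Fubini and translation invariance of Lebesgue measure show that some
translate of a Lebesgue null set is Gaussian null. The Cameron-Martin density is positive, so the
set itself is Gaussian null. This makes Rademacher's theorem available almost surely. -/
theorem stdGaussian_absolutelyContinuous {n : ℕ} : stdGaussian (E n) ≪ volume := by
  refine Measure.AbsolutelyContinuous.mk fun s hs h0 => ?_
  have hm : Measurable (s.indicator (1 : E n → ℝ≥0∞)) := measurable_one.indicator hs
  have key : ∫⁻ h : E n, ∫⁻ x : E n, s.indicator 1 (x + h) ∂(stdGaussian (E n)) ∂volume = 0 := by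
    rw [lintegral_lintegral_swap (by fun_prop)]
    have : ∀ x : E n, ∫⁻ h : E n, s.indicator (1 : E n → ℝ≥0∞) (x + h) ∂volume = 0 := by
      intro x
      rw [lintegral_add_left_eq_self (fun h => s.indicator (1 : E n → ℝ≥0∞) h),
        lintegral_indicator_one hs, h0]
    simp [this]
  rw [lintegral_eq_zero_iff (by fun_prop)] at key
  obtain ⟨h, hh⟩ := key.exists
  replace hh : ∫⁻ x : E n, s.indicator (1 : E n → ℝ≥0∞) (x + h) ∂(stdGaussian (E n)) = 0 := hh
  rw [lintegral_add_right_stdGaussian h hm, lintegral_eq_zero_iff (by fun_prop)] at hh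
  rw [← lintegral_indicator_one hs, lintegral_eq_zero_iff hm]
  filter_upwards [hh] with x hx
  simpa [(Real.exp_pos _).not_ge] using hx

/-! ### Gaussian concentration by the Maurey-Pisier rotation argument. -/

/-- Jensen's inequality; the lower Lebesgue integral spares a proof that the exponential is
integrable, since otherwise the right side is infinite. -/
theorem ofReal_exp_integral_le {α : Type*} [MeasurableSpace α] {μ : Measure α}
    [IsProbabilityMeasure μ] {g : α → ℝ} (hg : Integrable g μ) :
    ENNReal.ofReal (Real.exp (∫ x, g x ∂μ)) ≤ ∫⁻ x, ENNReal.ofReal (Real.exp (g x)) ∂μ := by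
  by_cases h : Integrable (fun x => Real.exp (g x)) μ
  · rw [← ofReal_integral_eq_lintegral_ofReal h (.of_forall fun x => (Real.exp_pos _).le)]
    exact ENNReal.ofReal_le_ofReal (convexOn_exp.map_integral_le (by fun_prop) isClosed_univ
      (by simp) hg h)
  · have : ∫⁻ x, ENNReal.ofReal (Real.exp (g x)) ∂μ = ⊤ := by
      by_contra hne
      refine h ⟨Real.continuous_exp.comp_aestronglyMeasurable hg.1, ?_⟩
      rw [hasFiniteIntegral_iff_ofReal (.of_forall fun x => (Real.exp_pos _).le)]
      exact lt_top_iff_ne_top.2 hne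
    rw [this]; exact le_top

/-- Integrate the derivative of `f` along the quarter circle `cos θ • x + sin θ • y` from `x` to
`y`, then apply Jensen in the path parameter. The velocity is `π/2` times the second component of
the rotated pair. -/
theorem ofReal_exp_sub_le {n : ℕ} {f : E n → ℝ} {L : ℝ≥0} (hf : LipschitzWith L f) (t : ℝ)
    (p : E n × E n)
    (hp : ∀ᵐ s ∂(volume.restrict (Set.Ioc (0 : ℝ) 1)),
      DifferentiableAt ℝ f (ContinuousLinearMap.rotation (s * (Real.pi / 2)) p).1) :
    ENNReal.ofReal (Real.exp (t * (f p.2 - f p.1))) ≤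
      ∫⁻ s, ENNReal.ofReal (Real.exp ((t * (Real.pi / 2)) *
        fderiv ℝ f (ContinuousLinearMap.rotation (s * (Real.pi / 2)) p).1
          (ContinuousLinearMap.rotation (s * (Real.pi / 2)) p).2))
        ∂(volume.restrict (Set.Ioc (0 : ℝ) 1)) := by
  obtain ⟨x, y⟩ := p
  simp only [ContinuousLinearMap.rotation_apply] at hp ⊢
  set u : ℝ → E n := fun s => Real.cos (s * (Real.pi / 2)) • x + Real.sin (s * (Real.pi / 2)) • y
    with hu
  have hder : ∀ s, HasDerivAt u ((Real.pi / 2) • (-Real.sin (s * (Real.pi / 2)) • x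
      + Real.cos (s * (Real.pi / 2)) • y)) s := by
    intro s
    have h1 : HasDerivAt (fun s : ℝ => s * (Real.pi / 2)) (Real.pi / 2) s := by
      simpa using (hasDerivAt_id s).mul_const (Real.pi / 2)
    have h2 := (h1.cos.smul_const x).add (h1.sin.smul_const y)
    refine h2.congr_deriv ?_
    rw [smul_add, smul_smul, smul_smul]
    congr 2 <;> ring
  have hlip : LipschitzWith (Real.toNNReal (Real.pi / 2 * (‖x‖ + ‖y‖))) u := by
    refine lipschitzWith_of_nnnorm_deriv_le (fun s => (hder s).differentiableAt) fun s => ?_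
    rw [(hder s).deriv, ← NNReal.coe_le_coe, coe_nnnorm, norm_smul, Real.coe_toNNReal _ (by positivity),
      Real.norm_of_nonneg (by positivity)]
    gcongr
    refine (norm_add_le _ _).trans ?_
    rw [norm_smul, norm_smul, norm_neg]
    exact add_le_add (mul_le_of_le_one_left (norm_nonneg _) (Real.abs_sin_le_one _))
      (mul_le_of_le_one_left (norm_nonneg _) (Real.abs_cos_le_one _))
  have hac : AbsolutelyContinuousOnInterval (f ∘ u) 0 1 :=
    ((hf.comp hlip).lipschitzOnWith).absolutelyContinuousOnInterval
  have hftc := hac.integral_deriv_eq_sub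
  have hae : ∀ᵐ s ∂(volume.restrict (Set.Ioc (0 : ℝ) 1)), t * deriv (f ∘ u) s =
      (t * (Real.pi / 2)) * fderiv ℝ f (u s) (-Real.sin (s * (Real.pi / 2)) • x
      + Real.cos (s * (Real.pi / 2)) • y) := by
    filter_upwards [hp] with s hs
    rw [(hs.hasFDerivAt.comp_hasDerivAt s (hder s)).deriv, map_smul, smul_eq_mul]
    ring
  have e0 : (f ∘ u) 0 = f x := by simp [hu]
  have e1 : (f ∘ u) 1 = f y := by simp [hu]
  rw [e0, e1, intervalIntegral.integral_of_le zero_le_one] at hftc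
  have hint := hac.intervalIntegrable_deriv
  rw [intervalIntegrable_iff_integrableOn_Ioc_of_le zero_le_one] at hint
  have hprob : IsProbabilityMeasure (volume.restrict (Set.Ioc (0 : ℝ) 1)) := ⟨by simp⟩
  have hJ := ofReal_exp_integral_le (hint.const_mul t)
  rw [integral_const_mul, hftc] at hJ
  refine hJ.trans_eq (lintegral_congr_ae ?_)
  filter_upwards [hae] with s hs
  rw [hs]

/-- For each parameter, position and normalized velocity on the quarter circle are again independent
standard Gaussians. Given the position, the exponent is therefore a Gaussian linear functional of
norm at most `|t| (π/2) L`, and `(π/2)² ≤ 3`. -/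
theorem lintegral_exp_sub_le {n : ℕ} {f : E n → ℝ} {L : ℝ≥0} (hf : LipschitzWith L f) (t : ℝ) :
    ∫⁻ p, ENNReal.ofReal (Real.exp (t * (f p.2 - f p.1)))
        ∂((stdGaussian (E n)).prod (stdGaussian (E n)))
      ≤ ENNReal.ofReal (Real.exp (3 * (L : ℝ) ^ 2 * t ^ 2 / 2)) := by
  set γ := stdGaussian (E n) with hγ
  have hrot : ∀ θ : ℝ, (γ.prod γ).map (ContinuousLinearMap.rotation θ) = γ.prod γ := fun θ =>
    IsGaussian.map_rotation_eq_self (by simp [hγ]) θ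
  have hDm : MeasurableSet {x | DifferentiableAt ℝ f x} := measurableSet_of_differentiableAt ℝ f
  have hrm : Measurable (fun q : (E n × E n) × ℝ =>
      ContinuousLinearMap.rotation (q.2 * (Real.pi / 2)) q.1) := by
    simp only [ContinuousLinearMap.rotation_apply]
    fun_prop
  have hFm : Measurable (fun q : E n × E n =>
      ENNReal.ofReal (Real.exp ((t * (Real.pi / 2)) * fderiv ℝ f q.1 q.2))) := by
    have h1 : Measurable (fun q : E n × E n => fderiv ℝ f q.1) :=
      (measurable_fderiv ℝ f).comp measurable_fst
    have : Measurable (fun q : E n × E n => fderiv ℝ f q.1 q.2) :=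
      isBoundedBilinearMap_apply.continuous.measurable.comp (h1.prodMk measurable_snd)
    fun_prop
  have hD : ∀ᵐ p ∂(γ.prod γ), DifferentiableAt ℝ f p.1 := by
    have h1 : ∀ᵐ x ∂γ, DifferentiableAt ℝ f x :=
      stdGaussian_absolutelyContinuous.ae_le hf.ae_differentiableAt
    exact Measure.quasiMeasurePreserving_fst.ae h1
  have hae : ∀ᵐ p ∂(γ.prod γ), ∀ᵐ s ∂(volume.restrict (Set.Ioc (0 : ℝ) 1)),
      DifferentiableAt ℝ f (ContinuousLinearMap.rotation (s * (Real.pi / 2)) p).1 := by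
    rw [Measure.ae_ae_comm (p := fun p s => DifferentiableAt ℝ f
      (ContinuousLinearMap.rotation (s * (Real.pi / 2)) p).1) ((measurable_fst.comp hrm) hDm)]
    refine .of_forall fun s => ?_
    rw [← hrot (s * (Real.pi / 2))] at hD
    exact ae_of_ae_map (ContinuousLinearMap.continuous _).aemeasurable hD
  calc ∫⁻ p, ENNReal.ofReal (Real.exp (t * (f p.2 - f p.1))) ∂(γ.prod γ)
      ≤ ∫⁻ p, ∫⁻ s, ENNReal.ofReal (Real.exp ((t * (Real.pi / 2)) *
        fderiv ℝ f (ContinuousLinearMap.rotation (s * (Real.pi / 2)) p).1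
          (ContinuousLinearMap.rotation (s * (Real.pi / 2)) p).2))
        ∂(volume.restrict (Set.Ioc (0 : ℝ) 1)) ∂(γ.prod γ) := by
        refine lintegral_mono_ae ?_
        filter_upwards [hae] with p hp using ofReal_exp_sub_le hf t p hp
    _ = ∫⁻ s, ∫⁻ p, ENNReal.ofReal (Real.exp ((t * (Real.pi / 2)) *
        fderiv ℝ f (ContinuousLinearMap.rotation (s * (Real.pi / 2)) p).1
          (ContinuousLinearMap.rotation (s * (Real.pi / 2)) p).2))
        ∂(γ.prod γ) ∂(volume.restrict (Set.Ioc (0 : ℝ) 1)) :=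
        lintegral_lintegral_swap (hFm.comp hrm).aemeasurable
    _ = ∫⁻ s, ∫⁻ p, ENNReal.ofReal (Real.exp ((t * (Real.pi / 2)) * fderiv ℝ f p.1 p.2))
        ∂(γ.prod γ) ∂(volume.restrict (Set.Ioc (0 : ℝ) 1)) := by
        refine lintegral_congr fun s => ?_
        conv_rhs => rw [← hrot (s * (Real.pi / 2))]
        rw [lintegral_map hFm (ContinuousLinearMap.continuous _).measurable]
    _ = ∫⁻ x, ∫⁻ y, ENNReal.ofReal (Real.exp ((t * (Real.pi / 2)) * fderiv ℝ f x y)) ∂γ ∂γ := by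
        rw [lintegral_const, lintegral_prod _ hFm.aemeasurable]
        simp
    _ ≤ ∫⁻ x, ENNReal.ofReal (Real.exp (3 * (L : ℝ) ^ 2 * t ^ 2 / 2)) ∂γ := by
        refine lintegral_mono fun x => ?_
        have h := lintegral_exp_dual ((t * (Real.pi / 2)) • fderiv ℝ f x)
        simp only [smul_apply, smul_eq_mul] at h
        rw [hγ, h]
        refine ENNReal.ofReal_le_ofReal (Real.exp_le_exp.2 ?_)
        have h1 : ‖fderiv ℝ f x‖ ≤ L := norm_fderiv_le_of_lipschitz ℝ hf
        have h2 : ‖fderiv ℝ f x‖ ^ 2 ≤ (L : ℝ) ^ 2 := by gcongr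
        have hpi : (Real.pi / 2) ^ 2 ≤ 3 := by
          have := Real.pi_lt_d2; have := Real.pi_pos; nlinarith
        rw [norm_smul, Real.norm_eq_abs, mul_pow, sq_abs, mul_pow]
        have : t ^ 2 * (Real.pi / 2) ^ 2 * ‖fderiv ℝ f x‖ ^ 2 ≤ t ^ 2 * 3 * (L : ℝ) ^ 2 := by
          gcongr
        linarith
    _ = ENNReal.ofReal (Real.exp (3 * (L : ℝ) ^ 2 * t ^ 2 / 2)) := by simp

/-- Gaussian concentration: a Lipschitz function of a standard Gaussian vector is sub-Gaussian. -/
theorem hasSubgaussianMGF_of_lipschitz {n : ℕ} {f : E n → ℝ} {L : ℝ≥0} (hf : LipschitzWith L f) :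
    HasSubgaussianMGF (fun x => f x - ∫ y, f y ∂(stdGaussian (E n))) (3 * L ^ 2)
      (stdGaussian (E n)) := by
  set γ := stdGaussian (E n) with hγ
  have hc := hf.continuous
  have hsub : ∀ c : ℝ, LipschitzWith L (fun x => f x - c) := fun c => by
    simpa using hf.sub (LipschitzWith.const c)
  have hint : ∀ t : ℝ, Integrable (fun x => Real.exp (t * (f x - ∫ y, f y ∂γ))) γ := fun t =>
    integrable_exp_of_lipschitz (hsub _) t
  refine ⟨hint, fun t => ?_⟩
  have hF : Measurable (fun p : E n × E n => ENNReal.ofReal (Real.exp (t * (f p.2 - f p.1)))) := by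
    fun_prop
  have key : ∫⁻ x, ENNReal.ofReal (Real.exp (t * (f x - ∫ y, f y ∂γ))) ∂γ
      ≤ ENNReal.ofReal (Real.exp (3 * (L : ℝ) ^ 2 * t ^ 2 / 2)) := by
    refine le_trans ?_ (lintegral_exp_sub_le hf t)
    -- The inner integral runs over an independent copy; Jensen there replaces that copy by its
    -- mean.
    rw [lintegral_prod_symm _ hF.aemeasurable]
    refine lintegral_mono fun x => ?_
    have hi : Integrable (fun y => t * (f x - f y)) γ :=
      ((integrable_const _).sub (integrable_of_lipschitz hf)).const_mul t
    refine le_trans (le_of_eq ?_) (ofReal_exp_integral_le hi)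
    rw [integral_const_mul]
    change _ = ENNReal.ofReal (Real.exp (t * ∫ y, (f x - f y) ∂γ))
    rw [integral_sub (integrable_const _) (integrable_of_lipschitz hf)]
    simp [hγ]
  rw [← ofReal_integral_eq_lintegral_ofReal (hint t) (.of_forall fun x => (Real.exp_pos _).le)] at key
  have := (ENNReal.ofReal_le_ofReal_iff (Real.exp_pos _).le).1 key
  simpa [mgf] using this

/-! ### Support functions, Gaussian width and its one-scale covering bound. -/

/-- The support function of a bounded set. -/
noncomputable def supportFn {n : ℕ} (T : Set (E n)) (x : E n) : ℝ := ⨆ t : T, inner ℝ x (t : E n)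

theorem gaussianWidth_eq {n : ℕ} (T : Set (E n)) :
    gaussianWidth T = ∫ x, supportFn T x ∂(stdGaussian (E n)) := rfl

theorem inner_le_supportFn {n : ℕ} {T : Set (E n)} {a : E n} {r : ℝ}
    (hT : T ⊆ Metric.closedBall a r) (x : E n) {t : E n} (ht : t ∈ T) :
    inner ℝ x t ≤ supportFn T x := by
  refine le_ciSup (f := fun t : T => inner ℝ x (t : E n)) ⟨inner ℝ x a + ‖x‖ * r, ?_⟩ ⟨t, ht⟩
  rintro _ ⟨⟨u, hu⟩, rfl⟩
  have h1 := hT hu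
  rw [mem_closedBall_iff_norm] at h1
  have h2 := real_inner_le_norm x (u - a)
  rw [inner_sub_right] at h2
  have := mul_le_mul_of_nonneg_left h1 (norm_nonneg x)
  change inner ℝ x u ≤ _
  linarith

theorem supportFn_le {n : ℕ} {T : Set (E n)} (hne : T.Nonempty) {x : E n} {M : ℝ}
    (h : ∀ t ∈ T, inner ℝ x t ≤ M) : supportFn T x ≤ M := by
  have : Nonempty T := hne.to_subtype
  exact ciSup_le fun t => h t t.2

/-- Subtracting `⟨x, a⟩` makes the Lipschitz constant depend on the radius of `T` and not on its
distance from the origin; the subtracted term has mean zero, so the width is unchanged. -/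
theorem lipschitzWith_supportFn_sub {n : ℕ} {T : Set (E n)} (hne : T.Nonempty) {a : E n} {r : ℝ}
    (hr : 0 ≤ r) (hT : T ⊆ Metric.closedBall a r) :
    LipschitzWith r.toNNReal (fun x => supportFn T x - inner ℝ x a) := by
  refine LipschitzWith.of_le_add_mul _ fun x y => ?_
  rw [Real.coe_toNNReal _ hr, sub_le_iff_le_add]
  refine supportFn_le hne fun t ht => ?_
  have h1 := inner_le_supportFn hT y ht
  have h2 := hT ht
  rw [mem_closedBall_iff_norm] at h2
  have h3 := real_inner_le_norm (x - y) (t - a)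
  rw [inner_sub_right, inner_sub_left, inner_sub_left] at h3
  have := mul_le_mul_of_nonneg_left h2 (norm_nonneg (x - y))
  rw [dist_eq_norm]
  linarith

theorem integrable_inner_left {n : ℕ} (a : E n) :
    Integrable (fun x : E n => inner ℝ x a) (stdGaussian (E n)) := by
  simp_rw [real_inner_comm a]
  exact integrable_of_lipschitz (innerSL ℝ a).lipschitz

theorem integral_inner_left {n : ℕ} (a : E n) :
    ∫ x : E n, inner ℝ x a ∂(stdGaussian (E n)) = 0 := by
  simp_rw [real_inner_comm a]
  exact integral_strongDual_stdGaussian (innerSL ℝ a)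

theorem integrable_supportFn {n : ℕ} {T : Set (E n)} (hne : T.Nonempty) {a : E n} {r : ℝ}
    (hr : 0 ≤ r) (hT : T ⊆ Metric.closedBall a r) :
    Integrable (supportFn T) (stdGaussian (E n)) := by
  refine ((integrable_of_lipschitz (lipschitzWith_supportFn_sub hne hr hT)).add
    (integrable_inner_left a)).congr (.of_forall fun x => ?_)
  simp

theorem integral_supportFn_sub {n : ℕ} {T : Set (E n)} (hne : T.Nonempty) {a : E n} {r : ℝ}
    (hr : 0 ≤ r) (hT : T ⊆ Metric.closedBall a r) (b : E n) :
    ∫ x, (supportFn T x - inner ℝ x b) ∂(stdGaussian (E n)) = gaussianWidth T := by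
  rw [integral_sub (integrable_supportFn hne hr hT) (integrable_inner_left b), integral_inner_left,
    sub_zero, gaussianWidth_eq]

theorem hasSubgaussianMGF_supportFn {n : ℕ} {T : Set (E n)} (hne : T.Nonempty) {a : E n} {r : ℝ}
    (hr : 0 ≤ r) (hT : T ⊆ Metric.closedBall a r) :
    HasSubgaussianMGF (fun x => supportFn T x - inner ℝ x a - gaussianWidth T)
      (3 * r.toNNReal ^ 2) (stdGaussian (E n)) := by
  have := hasSubgaussianMGF_of_lipschitz (lipschitzWith_supportFn_sub hne hr hT)
  rwa [integral_supportFn_sub hne hr hT] at this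

/-- The expected maximum of finitely many sub-Gaussian variables, in Laplace transform form. -/
theorem mul_integral_le_log_card_add {Ω ι : Type*} [MeasurableSpace Ω] {P : Measure Ω}
    [IsProbabilityMeasure P] {s : Finset ι} {X : Ω → ℝ} {W : ι → Ω → ℝ} {v : ℝ≥0}
    (hX : Integrable X P) (hW : ∀ i ∈ s, HasSubgaussianMGF (W i) v P)
    (hXW : ∀ ω, ∃ i ∈ s, X ω ≤ W i ω) {l : ℝ} (hl : 0 < l) :
    l * ∫ ω, X ω ∂P ≤ Real.log s.card + v * l ^ 2 / 2 := by
  have hle : ∀ ω, Real.exp (l * X ω) ≤ ∑ i ∈ s, Real.exp (l * W i ω) := fun ω => by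
    obtain ⟨i, hi, h⟩ := hXW ω
    refine le_trans (Real.exp_le_exp.2 (by gcongr)) (Finset.single_le_sum
      (f := fun i => Real.exp (l * W i ω)) (fun j _ => (Real.exp_pos _).le) hi)
  have hsum : Integrable (fun ω => ∑ i ∈ s, Real.exp (l * W i ω)) P :=
    integrable_finsetSum _ fun i hi => (hW i hi).integrable_exp_mul l
  have hexp : Integrable (fun ω => Real.exp (l * X ω)) P :=
    hsum.mono' (Real.continuous_exp.comp_aestronglyMeasurable (hX.const_mul l).1)
      (.of_forall fun ω => by rw [Real.norm_of_nonneg (Real.exp_pos _).le]; exact hle ω)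
  have h1 : Real.exp (∫ ω, l * X ω ∂P) ≤ ∫ ω, Real.exp (l * X ω) ∂P :=
    convexOn_exp.map_integral_le (by fun_prop) isClosed_univ (by simp) (hX.const_mul l) hexp
  have h2 : ∫ ω, Real.exp (l * X ω) ∂P ≤ s.card * Real.exp (v * l ^ 2 / 2) := by
    refine (integral_mono hexp hsum hle).trans ?_
    rw [integral_finsetSum _ fun i hi => (hW i hi).integrable_exp_mul l, ← nsmul_eq_mul]
    exact Finset.sum_le_card_nsmul _ _ _ fun i hi => (hW i hi).mgf_le l
  obtain ⟨ω⟩ : Nonempty Ω := nonempty_of_isProbabilityMeasure P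
  obtain ⟨i, hi, -⟩ := hXW ω
  have hcard : (0 : ℝ) < s.card := by exact_mod_cast Finset.card_pos.2 ⟨i, hi⟩
  have h3 := Real.log_le_log (Real.exp_pos _) (h1.trans h2)
  rwa [Real.log_exp, Real.log_mul hcard.ne' (Real.exp_pos _).ne', Real.log_exp,
    integral_const_mul] at h3

/-- The choice `t = √l / e` gives `1 + 6 = 7`. It degenerates for `l = 0`, where a small positive
`t` rules out `a > 0`. -/
theorem le_sqrt_of_forall_mul_le {a e l : ℝ} (he : 0 < e) (hl : 0 ≤ l)
    (h : ∀ t : ℝ, 0 < t → t * a ≤ l + 6 * e ^ 2 * t ^ 2) : a ≤ 7 * e * √l := by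
  rcases hl.eq_or_lt with rfl | hl
  · rw [Real.sqrt_zero, mul_zero]
    by_contra! ha
    have := h (a / (12 * e ^ 2)) (by positivity)
    have e1 : a / (12 * e ^ 2) * a = a ^ 2 / (12 * e ^ 2) := by ring
    have e2 : 0 + 6 * e ^ 2 * (a / (12 * e ^ 2)) ^ 2 = a ^ 2 / (12 * e ^ 2) / 2 := by
      field_simp; ring
    rw [e1, e2] at this
    have : 0 < a ^ 2 / (12 * e ^ 2) := by positivity
    linarith
  · have hs : 0 < √l := Real.sqrt_pos.2 hl
    have h1 := h (√l / e) (by positivity)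
    have e1 : l + 6 * e ^ 2 * (√l / e) ^ 2 = √l / e * (7 * e * √l) := by
      field_simp
      rw [Real.sq_sqrt hl.le]
      ring
    rw [e1] at h1
    exact le_of_mul_le_mul_left h1 (by positivity)

/-- The supremum over `B(μ, e) ∩ K` is at most the maximum of the suprema over the small balls, each
sub-Gaussian around a mean at most `m`. All are centered at the common point `μ`, about which they
have radius at most `2e`: the variance proxy is `3(2e)² = 12e²`, whence the `6e²` below. -/
theorem localWidth_le_of_cover {n : ℕ} {K : Set (E n)} {μ : E n} (hμ : μ ∈ K) {e r m M : ℝ}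
    (he : 0 < e) (hr : 0 ≤ r) (hre : r ≤ e) {N : Finset (E n)}
    (hN : ↑N ⊆ Metric.closedBall μ e ∩ K)
    (hcov : ∀ t ∈ Metric.closedBall μ e ∩ K, ∃ ν ∈ N, ‖t - ν‖ ≤ r)
    (hm : ∀ ν ∈ N, localWidth K ν r ≤ m) (hM : (N.card : ℝ) ≤ M) :
    localWidth K μ e ≤ m + 7 * e * √(Real.log M) := by
  set T : Set (E n) := Metric.closedBall μ e ∩ K with hTdef
  have hT : T ⊆ Metric.closedBall μ e := Set.inter_subset_left
  have hTne : T.Nonempty := ⟨μ, Metric.mem_closedBall_self he.le, hμ⟩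
  obtain ⟨ν₀, hν₀, -⟩ := hcov μ ⟨Metric.mem_closedBall_self he.le, hμ⟩
  have hcard : (1 : ℝ) ≤ N.card := by exact_mod_cast Finset.card_pos.2 ⟨ν₀, hν₀⟩
  set B : E n → Set (E n) := fun ν => Metric.closedBall ν r ∩ K with hB
  have hBne : ∀ ν ∈ N, (B ν).Nonempty := fun ν hν =>
    ⟨ν, Metric.mem_closedBall_self hr, (hN hν).2⟩
  have hBsub : ∀ ν ∈ N, B ν ⊆ Metric.closedBall μ (2 * e) := fun ν hν t ht => by
    have h1 := ht.1
    have h2 := (hN hν).1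
    rw [Metric.mem_closedBall] at *
    linarith [dist_triangle t ν μ]
  have hi : Integrable (fun x => supportFn T x - inner ℝ x μ) (stdGaussian (E n)) :=
    (integrable_supportFn hTne he.le hT).sub (integrable_inner_left μ)
  have key : ∀ l : ℝ, 0 < l → l * (localWidth K μ e - m) ≤ Real.log M + 6 * e ^ 2 * l ^ 2 := by
    intro l hl
    have h := mul_integral_le_log_card_add (s := N)
      (X := fun x => supportFn T x - inner ℝ x μ - m)
      (W := fun ν x => supportFn (B ν) x - inner ℝ x μ - gaussianWidth (B ν))
      (hi.sub (integrable_const m))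
      (fun ν hν => hasSubgaussianMGF_supportFn (hBne ν hν) (by positivity) (hBsub ν hν)) ?_ hl
    · have e1 : ∫ x, (supportFn T x - inner ℝ x μ - m) ∂(stdGaussian (E n))
          = localWidth K μ e - m := by
        rw [integral_sub hi (integrable_const m), integral_supportFn_sub hTne he.le hT]
        simp [localWidth, hTdef]
      rw [e1] at h
      refine h.trans (add_le_add (Real.log_le_log (by linarith) hM) (le_of_eq ?_))
      push_cast
      rw [Real.coe_toNNReal _ (by positivity)]
      ring
    · intro x
      obtain ⟨ν, hν, hmax⟩ := N.exists_max_image (fun ν => supportFn (B ν) x) ⟨ν₀, hν₀⟩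
      refine ⟨ν, hν, ?_⟩
      have h1 : supportFn T x ≤ supportFn (B ν) x := by
        refine supportFn_le hTne fun t ht => ?_
        obtain ⟨ν', hν', h⟩ := hcov t ht
        exact (inner_le_supportFn (hBsub ν' hν') x
          ⟨mem_closedBall_iff_norm.2 h, ht.2⟩).trans (hmax ν' hν')
      have h2 : gaussianWidth (B ν) ≤ m := hm ν hν
      linarith
  have := le_sqrt_of_forall_mul_le he (Real.log_nonneg (hcard.trans hM)) key
  linarith

/-! ### The metric projection and the variational description of its error. -/

theorem isLeastSquares_lse {n : ℕ} {K : Set (E n)} (hne : K.Nonempty) (hcl : IsClosed K)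
    (hcv : Convex ℝ K) (y : E n) : IsLeastSquares K y (lse K y) :=
  (isLeastSquares_iff hne hcl hcv y _).2 rfl

theorem inner_sub_lse_le {n : ℕ} {K : Set (E n)} (hne : K.Nonempty) (hcl : IsClosed K)
    (hcv : Convex ℝ K) (y : E n) {ν : E n} (hν : ν ∈ K) :
    inner ℝ (y - lse K y) (ν - lse K y) ≤ (0 : ℝ) := by
  have h := isLeastSquares_lse hne hcl hcv y
  have : Nonempty K := hne.to_subtype
  refine (norm_eq_iInf_iff_real_inner_le_zero hcv h.1).1 (le_antisymm ?_ ?_) ν hν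
  · exact le_ciInf fun w => h.2 w w.2
  · exact ciInf_le (f := fun w : K => ‖y - (w : E n)‖)
      ⟨0, by rintro _ ⟨w, rfl⟩; exact norm_nonneg _⟩ ⟨_, h.1⟩

theorem lipschitzWith_lse {n : ℕ} {K : Set (E n)} (hne : K.Nonempty) (hcl : IsClosed K)
    (hcv : Convex ℝ K) : LipschitzWith 1 (lse K) := by
  refine LipschitzWith.of_dist_le_mul fun y z => ?_
  rw [NNReal.coe_one, one_mul, dist_eq_norm, dist_eq_norm]
  set a := lse K y
  set b := lse K z
  have h1 : inner ℝ (y - a) (b - a) ≤ (0 : ℝ) :=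
    inner_sub_lse_le hne hcl hcv y (isLeastSquares_lse hne hcl hcv z).1
  have h2 : inner ℝ (z - b) (a - b) ≤ (0 : ℝ) :=
    inner_sub_lse_le hne hcl hcv z (isLeastSquares_lse hne hcl hcv y).1
  have h3 : inner ℝ (y - z) (a - b) = ‖a - b‖ ^ 2 - inner ℝ (y - a) (b - a)
      - inner ℝ (z - b) (a - b) := by
    rw [← real_inner_self_eq_norm_sq, ← neg_sub a b, inner_neg_right, sub_neg_eq_add,
      ← inner_add_left, ← inner_sub_left]
    congr 1
    abel
  have h4 := real_inner_le_norm (y - z) (a - b)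
  by_contra! h
  have h5 : 0 < ‖a - b‖ := (norm_nonneg _).trans_lt h
  nlinarith

/-- The distance from the least squares estimator to the true mean. -/
noncomputable def lseError {n : ℕ} (K : Set (E n)) (σ : ℝ) (μ x : E n) : ℝ :=
  ‖lse K (μ + σ • x) - μ‖

theorem continuous_lseError {n : ℕ} {K : Set (E n)} (hne : K.Nonempty) (hcl : IsClosed K)
    (hcv : Convex ℝ K) (σ : ℝ) (μ : E n) : Continuous (lseError K σ μ) := by
  have := (lipschitzWith_lse hne hcl hcv).continuous
  unfold lseError
  fun_prop

/-- The centered support function of `B(μ, s) ∩ K`. -/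
noncomputable def localSup {n : ℕ} (K : Set (E n)) (μ : E n) (s : ℝ) (x : E n) : ℝ :=
  supportFn (Metric.closedBall μ s ∩ K) x - inner ℝ x μ

theorem nonempty_closedBall_inter {n : ℕ} {K : Set (E n)} {μ : E n} (hμ : μ ∈ K) {s : ℝ}
    (hs : 0 ≤ s) : (Metric.closedBall μ s ∩ K).Nonempty :=
  ⟨μ, Metric.mem_closedBall_self hs, hμ⟩

theorem inner_sub_le_localSup {n : ℕ} {K : Set (E n)} {μ : E n} {s : ℝ} (x : E n) {t : E n}
    (ht : t ∈ K) (hts : ‖t - μ‖ ≤ s) : inner ℝ x (t - μ) ≤ localSup K μ s x := by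
  have := inner_le_supportFn (T := Metric.closedBall μ s ∩ K) Set.inter_subset_left x
    ⟨mem_closedBall_iff_norm.2 hts, ht⟩
  rw [inner_sub_right, localSup]
  linarith

theorem localSup_le {n : ℕ} {K : Set (E n)} {μ : E n} (hμ : μ ∈ K) {s : ℝ} (hs : 0 ≤ s) {x : E n}
    {M : ℝ} (h : ∀ t ∈ K, ‖t - μ‖ ≤ s → inner ℝ x (t - μ) ≤ M) : localSup K μ s x ≤ M := by
  rw [localSup, sub_le_iff_le_add]
  refine supportFn_le (nonempty_closedBall_inter hμ hs) fun t ht => ?_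
  have := h t ht.2 (mem_closedBall_iff_norm.1 ht.1)
  rw [inner_sub_right] at this
  linarith

theorem integrable_localSup {n : ℕ} {K : Set (E n)} {μ : E n} (hμ : μ ∈ K) {s : ℝ} (hs : 0 ≤ s) :
    Integrable (localSup K μ s) (stdGaussian (E n)) :=
  (integrable_supportFn (nonempty_closedBall_inter hμ hs) hs Set.inter_subset_left).sub
    (integrable_inner_left μ)

theorem integral_localSup {n : ℕ} {K : Set (E n)} {μ : E n} (hμ : μ ∈ K) {s : ℝ} (hs : 0 ≤ s) :
    ∫ x, localSup K μ s x ∂(stdGaussian (E n)) = localWidth K μ s :=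
  integral_supportFn_sub (nonempty_closedBall_inter hμ hs) hs Set.inter_subset_left μ

theorem hasSubgaussianMGF_localSup {n : ℕ} {K : Set (E n)} {μ : E n} (hμ : μ ∈ K) {s : ℝ}
    (hs : 0 ≤ s) : HasSubgaussianMGF (fun x => localSup K μ s x - localWidth K μ s)
      (3 * s.toNNReal ^ 2) (stdGaussian (E n)) :=
  hasSubgaussianMGF_supportFn (nonempty_closedBall_inter hμ hs) hs Set.inter_subset_left

/-- The point `(1 - l) t + l u` of a convex set, with bounds on its norm and pairing. -/
theorem exists_mem_segment {n : ℕ} {K : Set (E n)} (hcv : Convex ℝ K) {μ t u : E n} (ht : t ∈ K)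
    (hu : u ∈ K) {a b l : ℝ} (hta : ‖t - μ‖ ≤ a) (hub : ‖u - μ‖ ≤ b) (hl0 : 0 ≤ l) (hl1 : l ≤ 1)
    (x : E n) : ∃ v ∈ K, ‖v - μ‖ ≤ (1 - l) * a + l * b ∧
      inner ℝ x (v - μ) = (1 - l) * inner ℝ x (t - μ) + l * inner ℝ x (u - μ) := by
  refine ⟨(1 - l) • t + l • u, hcv ht hu (by linarith) hl0 (by ring), ?_, ?_⟩
  all_goals
    have e : (1 - l) • t + l • u - μ = (1 - l) • (t - μ) + l • (u - μ) := by
      module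
    rw [e]
  · refine (norm_add_le _ _).trans ?_
    rw [norm_smul, norm_smul, Real.norm_of_nonneg hl0, Real.norm_of_nonneg (sub_nonneg.2 hl1)]
    have := sub_nonneg.2 hl1
    gcongr
  · rw [inner_add_right, inner_smul_right, inner_smul_right]

/-- Convex combinations of competitors for radii `a` and `b` compete for the combined radius. -/
theorem localSup_concave {n : ℕ} {K : Set (E n)} (hcv : Convex ℝ K) {μ : E n} (hμ : μ ∈ K)
    {a b l : ℝ} (ha : 0 ≤ a) (hb : 0 ≤ b) (hl0 : 0 ≤ l) (hl1 : l ≤ 1) (x : E n) :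
    (1 - l) * localSup K μ a x + l * localSup K μ b x ≤ localSup K μ ((1 - l) * a + l * b) x := by
  rcases hl0.eq_or_lt with rfl | hl0'
  · simp
  rcases hl1.eq_or_lt with rfl | hl1'
  · simp
  have h1 : localSup K μ b x ≤
      (localSup K μ ((1 - l) * a + l * b) x - (1 - l) * localSup K μ a x) / l := by
    refine localSup_le hμ hb fun u hu hub => ?_
    rw [le_div_iff₀ hl0']
    have h2 : localSup K μ a x ≤
        (localSup K μ ((1 - l) * a + l * b) x - inner ℝ x (u - μ) * l) / (1 - l) := by
      refine localSup_le hμ ha fun t ht hta => ?_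
      rw [le_div_iff₀ (by linarith)]
      obtain ⟨v, hv, hv1, hv2⟩ := exists_mem_segment hcv ht hu hta hub hl0 hl1 x
      have := inner_sub_le_localSup x hv hv1
      linarith
    rw [le_div_iff₀ (by linarith)] at h2
    linarith
  rw [le_div_iff₀ hl0'] at h1
  linarith

theorem localWidth_concave {n : ℕ} {K : Set (E n)} (hcv : Convex ℝ K) {μ : E n} (hμ : μ ∈ K)
    {a b l : ℝ} (ha : 0 ≤ a) (hb : 0 ≤ b) (hl0 : 0 ≤ l) (hl1 : l ≤ 1) :
    (1 - l) * localWidth K μ a + l * localWidth K μ b ≤ localWidth K μ ((1 - l) * a + l * b) := by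
  have h1 := sub_nonneg.2 hl1
  have hc : 0 ≤ (1 - l) * a + l * b := by positivity
  rw [← integral_localSup hμ ha, ← integral_localSup hμ hb, ← integral_localSup hμ hc,
    ← integral_const_mul, ← integral_const_mul, ← integral_add
      ((integrable_localSup hμ ha).const_mul _) ((integrable_localSup hμ hb).const_mul _)]
  exact integral_mono (((integrable_localSup hμ ha).const_mul _).add
    ((integrable_localSup hμ hb).const_mul _)) (integrable_localSup hμ hc)
    fun x => localSup_concave hcv hμ ha hb hl0 hl1 x

theorem localWidth_le_localWidth_add {n : ℕ} {K : Set (E n)} {μ ν : E n} (hμ : μ ∈ K)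
    (hν : ν ∈ K) {r : ℝ} (hr : 0 ≤ r) :
    localWidth K μ r ≤ localWidth K ν (r + ‖μ - ν‖) := by
  have hs : 0 ≤ r + ‖μ - ν‖ := by positivity
  refine integral_mono
    (integrable_supportFn (nonempty_closedBall_inter hμ hr) hr Set.inter_subset_left)
    (integrable_supportFn (nonempty_closedBall_inter hν hs) hs Set.inter_subset_left) fun x => ?_
  refine supportFn_le (nonempty_closedBall_inter hμ hr) fun t ht =>
    inner_le_supportFn Set.inter_subset_left x ⟨?_, ht.2⟩
  have h1 := mem_closedBall_iff_norm.1 ht.1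
  rw [mem_closedBall_iff_norm]
  have h2 := norm_sub_le_norm_sub_add_norm_sub t μ ν
  linarith

/-- Chatterjee's variational principle: `s ↦ σ Z(s) - s² / 2` is monotone towards the error of the
least squares estimator. -/
theorem localSup_le_localSup_of_between {n : ℕ} {K : Set (E n)} (hcl : IsClosed K)
    (hcv : Convex ℝ K) {μ : E n} (hμ : μ ∈ K) {σ : ℝ} (hσ : 0 < σ) {p l : ℝ} (hp : 0 ≤ p)
    (hl0 : 0 ≤ l) (hl1 : l ≤ 1) (x : E n) :
    σ * localSup K μ p x - p ^ 2 / 2 ≤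
      σ * localSup K μ ((1 - l) * p + l * lseError K σ μ x) x
        - ((1 - l) * p + l * lseError K σ μ x) ^ 2 / 2 := by
  set q := (1 - l) * p + l * lseError K σ μ x with hq
  set v := lse K (μ + σ • x) with hv
  have hls := isLeastSquares_lse ⟨μ, hμ⟩ hcl hcv (μ + σ • x)
  have key : localSup K μ p x ≤ (σ * localSup K μ q x - q ^ 2 / 2 + p ^ 2 / 2) / σ := by
    refine localSup_le hμ hp fun t ht htp => ?_
    rw [le_div_iff₀ hσ]
    obtain ⟨w, hw, hw1, hw2⟩ := exists_mem_segment hcv ht hls.1 htp (le_refl ‖v - μ‖) hl0 hl1 x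
    have h1 : inner ℝ x (w - μ) ≤ localSup K μ q x := inner_sub_le_localSup x hw hw1
    -- Optimality of `v` against `t`. Expanded, it says that `t` does not beat `v` in `σ⟨x, · - μ⟩ -
    -- ‖· - μ‖²/2`; convexity of the square then passes to the intermediate point `w`.
    have h2 : ‖σ • x - (v - μ)‖ ^ 2 ≤ ‖σ • x - (t - μ)‖ ^ 2 := by
      have := hls.2 t ht
      rw [← hv] at this
      have e : ∀ z : E n, μ + σ • x - z = σ • x - (z - μ) := fun z => by abel
      rw [e, e] at this
      gcongr
    rw [norm_sub_sq_real (σ • x) (v - μ), norm_sub_sq_real (σ • x) (t - μ), real_inner_smul_left, real_inner_smul_left] at h2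
    have h3 : ‖t - μ‖ ^ 2 ≤ p ^ 2 := by gcongr
    have hE : lseError K σ μ x = ‖v - μ‖ := rfl
    rw [hE] at hq
    have h5 := mul_le_mul_of_nonneg_left h1 hσ.le
    rw [hw2] at h5
    have h6 : q ^ 2 ≤ (1 - l) * p ^ 2 + l * ‖v - μ‖ ^ 2 := by
      have : 0 ≤ l * (1 - l) * (p - ‖v - μ‖) ^ 2 := by
        have := sub_nonneg.2 hl1
        positivity
      rw [hq]
      nlinarith
    have h7 := mul_le_mul_of_nonneg_left
      (show σ * inner ℝ x (t - μ) - p ^ 2 / 2 ≤ σ * inner ℝ x (v - μ) - ‖v - μ‖ ^ 2 / 2 by linarith)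
      hl0
    linarith
  rw [le_div_iff₀ hσ] at key
  linarith

theorem localSup_le_of_le_lseError {n : ℕ} {K : Set (E n)} (hcl : IsClosed K)
    (hcv : Convex ℝ K) {μ : E n} (hμ : μ ∈ K) {σ : ℝ} (hσ : 0 < σ) {p q : ℝ} (hp : 0 ≤ p)
    (hpq : p < q) {x : E n} (hq : q ≤ lseError K σ μ x) :
    σ * localSup K μ p x - p ^ 2 / 2 ≤ σ * localSup K μ q x - q ^ 2 / 2 := by
  have hd : 0 < lseError K σ μ x - p := by linarith
  have h := localSup_le_localSup_of_between hcl hcv hμ hσ (l := (q - p) / (lseError K σ μ x - p)) hp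
    (div_nonneg (by linarith) hd.le) ((div_le_one hd).2 (by linarith)) x
  have e : (1 - (q - p) / (lseError K σ μ x - p)) * p
      + (q - p) / (lseError K σ μ x - p) * lseError K σ μ x = q := by
    field_simp
    ring
  rwa [e] at h

theorem localSup_le_of_lseError_le {n : ℕ} {K : Set (E n)} (hcl : IsClosed K)
    (hcv : Convex ℝ K) {μ : E n} (hμ : μ ∈ K) {σ : ℝ} (hσ : 0 < σ) {p q : ℝ} (hp : 0 ≤ p)
    (hqp : q < p) {x : E n} (hq : lseError K σ μ x ≤ q) :
    σ * localSup K μ p x - p ^ 2 / 2 ≤ σ * localSup K μ q x - q ^ 2 / 2 := by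
  have hd : 0 < p - lseError K σ μ x := by linarith
  have h := localSup_le_localSup_of_between hcl hcv hμ hσ (l := (p - q) / (p - lseError K σ μ x)) hp
    (div_nonneg (by linarith) hd.le) ((div_le_one hd).2 (by linarith)) x
  have e : (1 - (p - q) / (p - lseError K σ μ x)) * p
      + (p - q) / (p - lseError K σ μ x) * lseError K σ μ x = q := by
    field_simp
    ring
  rwa [e] at h

/-! ### From probabilities of the error to the worst case rate. -/

theorem ofReal_lseError {n : ℕ} (K : Set (E n)) (σ : ℝ) (μ x : E n) :
    ENNReal.ofReal (lseError K σ μ x) = ‖lse K (μ + σ • x) - μ‖ₑ :=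
  ofReal_norm _

theorem rpow_half_sq (a : ℝ≥0∞) : (a ^ 2) ^ (1 / 2 : ℝ) = a := by
  rw [← ENNReal.rpow_natCast, ← ENNReal.rpow_mul]
  norm_num

theorem worstRate_le {n : ℕ} {K : Set (E n)} {σ : ℝ} {a : ℝ≥0∞}
    (h : ∀ μ ∈ K, ∫⁻ x, ENNReal.ofReal (lseError K σ μ x) ^ 2 ∂(stdGaussian (E n)) ≤ a ^ 2) :
    worstRate K σ ≤ a := by
  simp_rw [ofReal_lseError] at h
  rw [worstRate, ← rpow_half_sq a]
  exact ENNReal.rpow_le_rpow (iSup₂_le h) (by norm_num)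

theorem le_worstRate {n : ℕ} {K : Set (E n)} {σ a r : ℝ} (hne : K.Nonempty) (hcl : IsClosed K)
    (hcv : Convex ℝ K) {μ : E n} (hμ : μ ∈ K) (ha : 0 ≤ a)
    (h : a ^ 2 ≤ (stdGaussian (E n)).real {x | r ≤ lseError K σ μ x}) :
    ENNReal.ofReal (a * r) ≤ worstRate K σ := by
  have hm : Measurable fun x => ENNReal.ofReal (lseError K σ μ x) ^ 2 :=
    (continuous_lseError hne hcl hcv σ μ).measurable.ennreal_ofReal.pow_const 2
  rw [worstRate, ← rpow_half_sq (ENNReal.ofReal (a * r))]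
  refine ENNReal.rpow_le_rpow ?_ (by norm_num)
  refine le_trans ?_ (le_iSup₂ μ hμ)
  simp_rw [← ofReal_lseError]
  rw [ENNReal.ofReal_mul ha, mul_pow, mul_comm, ← ENNReal.ofReal_pow ha]
  refine le_trans ?_ (mul_meas_ge_le_lintegral hm (ENNReal.ofReal r ^ 2))
  gcongr
  rw [← ofReal_measureReal]
  refine (ENNReal.ofReal_le_ofReal h).trans (ENNReal.ofReal_le_ofReal (measureReal_mono ?_))
  intro x hx
  rw [Set.mem_ofPred_eq] at hx ⊢
  gcongr

theorem worstRate_le_ediam {n : ℕ} {K : Set (E n)} (hne : K.Nonempty) (hcl : IsClosed K)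
    (hcv : Convex ℝ K) (σ : ℝ) : worstRate K σ ≤ Metric.ediam K := by
  refine worstRate_le fun μ hμ => ?_
  calc ∫⁻ x, ENNReal.ofReal (lseError K σ μ x) ^ 2 ∂(stdGaussian (E n))
      ≤ ∫⁻ x, Metric.ediam K ^ 2 ∂(stdGaussian (E n)) := by
        refine lintegral_mono fun x => ?_
        rw [ofReal_lseError, ← edist_eq_enorm_sub]
        gcongr
        exact Metric.edist_le_ediam_of_mem (isLeastSquares_lse hne hcl hcv _).1 hμ
    _ = Metric.ediam K ^ 2 := by simp

/-- Polynomial tails of order four bound the second moment. -/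
theorem lintegral_sq_le_of_tail {Ω : Type*} [MeasurableSpace Ω] {P : Measure Ω}
    [IsProbabilityMeasure P] {X : Ω → ℝ} (hX : Measurable X) {s₀ C : ℝ} (hs₀ : 0 < s₀) (hC : 0 ≤ C)
    (h : ∀ s, s₀ ≤ s → P.real {ω | s ≤ X ω} ≤ C * s₀ ^ 4 / s ^ 4) :
    ∫⁻ ω, ENNReal.ofReal (X ω) ^ 2 ∂P ≤ ENNReal.ofReal ((1 + 6 * C) * s₀ ^ 2) := by
  -- Dyadic decomposition: the level `2^k s₀` contributes `4^(k+1) s₀²` with probability at most `C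
  -- / 16^k`, a geometric series with sum `(16/3) C s₀²`.
  have hpt : ∀ ω, ENNReal.ofReal (X ω) ^ 2 ≤ ENNReal.ofReal (s₀ ^ 2) +
      ∑' k : ℕ, {ω | 2 ^ k * s₀ ≤ X ω}.indicator
        (fun _ => ENNReal.ofReal (4 ^ (k + 1) * s₀ ^ 2)) ω := by
    intro ω
    by_cases hω : X ω < s₀
    · refine le_trans ?_ le_self_add
      rw [ENNReal.ofReal_pow hs₀.le]
      gcongr
    · push Not at hω
      obtain ⟨k, hk1, hk2⟩ := exists_nat_pow_near ((one_le_div hs₀).2 hω) (one_lt_two (α := ℝ))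
      rw [le_div_iff₀ hs₀] at hk1
      rw [div_lt_iff₀ hs₀] at hk2
      refine le_trans ?_ le_add_self
      refine le_trans ?_ (ENNReal.le_tsum k)
      rw [Set.indicator_of_mem (by exact hk1), ← ENNReal.ofReal_pow (hs₀.le.trans hω)]
      refine ENNReal.ofReal_le_ofReal ?_
      have : (4 : ℝ) ^ (k + 1) * s₀ ^ 2 = (2 ^ (k + 1) * s₀) ^ 2 := by
        rw [mul_pow, ← pow_mul, mul_comm (k + 1) 2, pow_mul]; norm_num
      rw [this]
      exact pow_le_pow_left₀ (hs₀.le.trans hω) hk2.le 2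
  have hm : ∀ k : ℕ, MeasurableSet {ω | 2 ^ k * s₀ ≤ X ω} := fun k =>
    measurableSet_le measurable_const hX
  have hterm : ∀ k : ℕ, ENNReal.ofReal (4 ^ (k + 1) * s₀ ^ 2) * P {ω | 2 ^ k * s₀ ≤ X ω}
      ≤ ENNReal.ofReal (4 * C * s₀ ^ 2 * (1 / 4) ^ k) := by
    intro k
    rw [← ofReal_measureReal, ← ENNReal.ofReal_mul (by positivity)]
    refine ENNReal.ofReal_le_ofReal ?_
    have h1 := h (2 ^ k * s₀) (le_mul_of_one_le_left hs₀.le (one_le_pow₀ one_le_two))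
    refine (mul_le_mul_of_nonneg_left h1 (by positivity)).trans (le_of_eq ?_)
    have e : ((2 : ℝ) ^ k * s₀) ^ 4 = 4 ^ k * 4 ^ k * s₀ ^ 4 := by
      rw [mul_pow, ← pow_mul, mul_comm k 4, pow_mul, ← mul_pow]; norm_num
    rw [e, pow_succ, one_div, inv_pow]
    field_simp
  calc ∫⁻ ω, ENNReal.ofReal (X ω) ^ 2 ∂P
      ≤ ∫⁻ ω, (ENNReal.ofReal (s₀ ^ 2) + ∑' k : ℕ, {ω | 2 ^ k * s₀ ≤ X ω}.indicator
        (fun _ => ENNReal.ofReal (4 ^ (k + 1) * s₀ ^ 2)) ω) ∂P := lintegral_mono hpt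
    _ = ENNReal.ofReal (s₀ ^ 2) + ∑' k : ℕ, ENNReal.ofReal (4 ^ (k + 1) * s₀ ^ 2)
        * P {ω | 2 ^ k * s₀ ≤ X ω} := by
        rw [lintegral_add_left measurable_const, lintegral_tsum fun k =>
          (measurable_const.indicator (hm k)).aemeasurable]
        simp_rw [lintegral_indicator_const (hm _)]
        simp
    _ ≤ ENNReal.ofReal (s₀ ^ 2) + ∑' k : ℕ, ENNReal.ofReal (4 * C * s₀ ^ 2 * (1 / 4) ^ k) := by
        gcongr with k
        exact hterm k
    _ = ENNReal.ofReal (s₀ ^ 2 + 4 * C * s₀ ^ 2 * (4 / 3)) := by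
        have hs : HasSum (fun k : ℕ => 4 * C * s₀ ^ 2 * (1 / 4 : ℝ) ^ k) (4 * C * s₀ ^ 2 * (4 / 3)) := by
          have := (hasSum_geometric_of_lt_one (r := (1 / 4 : ℝ)) (by norm_num) (by norm_num)).mul_left
            (4 * C * s₀ ^ 2)
          norm_num at this ⊢
          exact this
        rw [← ENNReal.ofReal_tsum_of_nonneg (fun k => by positivity) hs.summable, hs.tsum_eq,
          ENNReal.ofReal_add (by positivity) (by positivity)]
    _ ≤ ENNReal.ofReal ((1 + 6 * C) * s₀ ^ 2) := by
        refine ENNReal.ofReal_le_ofReal ?_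
        nlinarith [mul_nonneg hC (sq_nonneg s₀)]

/-! ### Increments of the local width control the error. -/

theorem exp_neg_le_two_div_sq {y : ℝ} (hy : 0 < y) : Real.exp (-y) ≤ 2 / y ^ 2 := by
  have h := Real.quadratic_le_exp_of_nonneg hy.le
  rw [Real.exp_neg, inv_le_comm₀ (Real.exp_pos _) (by positivity), inv_div]
  nlinarith

theorem measureReal_add_le_localSup {n : ℕ} {K : Set (E n)} {μ : E n} (hμ : μ ∈ K) {s u : ℝ}
    (hs : 0 ≤ s) (hu : 0 ≤ u) :
    (stdGaussian (E n)).real {x | localWidth K μ s + u ≤ localSup K μ s x}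
      ≤ Real.exp (-u ^ 2 / (6 * s ^ 2)) := by
  have h := (hasSubgaussianMGF_localSup hμ hs).measure_ge_le hu
  refine le_trans (le_of_eq ?_) (h.trans (le_of_eq ?_))
  · congr 1
    ext x
    simp [le_sub_iff_add_le, add_comm]
  · push_cast
    rw [Real.coe_toNNReal _ hs]
    congr 2
    ring

theorem measureReal_localSup_le_sub {n : ℕ} {K : Set (E n)} {μ : E n} (hμ : μ ∈ K) {s u : ℝ}
    (hs : 0 ≤ s) (hu : 0 ≤ u) :
    (stdGaussian (E n)).real {x | localSup K μ s x ≤ localWidth K μ s - u}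
      ≤ Real.exp (-u ^ 2 / (6 * s ^ 2)) := by
  have h := (hasSubgaussianMGF_localSup hμ hs).neg.measure_ge_le hu
  refine le_trans (le_of_eq ?_) (h.trans (le_of_eq ?_))
  · congr 1
    ext x
    simp only [Set.mem_ofPred_eq, Pi.neg_apply]
    constructor <;> intro h <;> linarith
  · push_cast
    rw [Real.coe_toNNReal _ hs]
    congr 2
    ring

/-- If the local width grows slowly between `s / c` and `s`, the error is unlikely to exceed `s`. -/
theorem measureReal_le_lseError {n : ℕ} {K : Set (E n)} (hcl : IsClosed K)
    (hcv : Convex ℝ K) {μ : E n} (hμ : μ ∈ K) {σ c s : ℝ} (hσ : 0 < σ) (hc : 2 < c) (hs : 0 < s)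
    (hw : localWidth K μ s - localWidth K μ (s / c) ≤ s ^ 2 * (1 - 4 / c ^ 2) / (4 * σ)) :
    (stdGaussian (E n)).real {x | s ≤ lseError K σ μ x} ≤ 4000000 * σ ^ 4 / s ^ 4 := by
  have hsc : 0 < s / c := by positivity
  have hsc' : s / c ≤ s / 2 := by gcongr
  -- If the error reaches `s`, then `σ(Z(s) - Z(s/c)) ≥ (s² - (s/c)²)/2`. Without a deviation by
  -- `u`, the left side is below `s²/4 - (s/c)² + 2σu`, and `2σu = 3s²/16` keeps this too small.
  set u := 3 / 32 * s ^ 2 / σ with hu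
  have hu0 : 0 ≤ u := by positivity
  have hsub : {x | s ≤ lseError K σ μ x} ⊆ {x | localWidth K μ s + u ≤ localSup K μ s x} ∪
      {x | localSup K μ (s / c) x ≤ localWidth K μ (s / c) - u} := by
    intro x hx
    have h := localSup_le_of_le_lseError hcl hcv hμ hσ hsc.le (by linarith) hx
    by_contra hcon
    simp only [Set.mem_union, Set.mem_ofPred_eq, not_or, not_le] at hcon
    have h1 : localSup K μ s x - localSup K μ (s / c) x <
        s ^ 2 * (1 - 4 / c ^ 2) / (4 * σ) + 2 * u := by linarith
    have h2 := mul_lt_mul_of_pos_left h1 hσ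
    have e : σ * (s ^ 2 * (1 - 4 / c ^ 2) / (4 * σ) + 2 * u)
        = s ^ 2 * (1 - 4 / c ^ 2) / 4 + 3 / 16 * s ^ 2 := by
      rw [hu]; field_simp; ring
    have e2 : s ^ 2 * (1 - 4 / c ^ 2) = s ^ 2 - 4 * (s / c) ^ 2 := by ring
    have h3 : (s / c) ^ 2 ≤ (s / 2) ^ 2 := by gcongr
    rw [e, e2] at h2
    nlinarith
  have hb : ∀ a, 0 < a → a ≤ s → Real.exp (-u ^ 2 / (6 * a ^ 2)) ≤ 2000000 * σ ^ 4 / s ^ 4 := by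
    intro a ha has
    have h1 : s ^ 2 / (1000 * σ ^ 2) ≤ u ^ 2 / (6 * a ^ 2) := by
      have : a ^ 2 ≤ s ^ 2 := by gcongr
      calc s ^ 2 / (1000 * σ ^ 2) ≤ u ^ 2 / (6 * s ^ 2) := by
            rw [hu, div_le_div_iff₀ (by positivity) (by positivity)]
            field_simp
            norm_num
        _ ≤ u ^ 2 / (6 * a ^ 2) := by gcongr
    rw [neg_div]
    refine (Real.exp_le_exp.2 (neg_le_neg h1)).trans ((exp_neg_le_two_div_sq (by positivity)).trans
      (le_of_eq ?_))
    field_simp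
    norm_num
  calc (stdGaussian (E n)).real {x | s ≤ lseError K σ μ x} ≤ _ := measureReal_mono hsub
    _ ≤ _ := measureReal_union_le _ _
    _ ≤ 2000000 * σ ^ 4 / s ^ 4 + 2000000 * σ ^ 4 / s ^ 4 := add_le_add
        ((measureReal_add_le_localSup hμ hs.le hu0).trans (hb s hs le_rfl))
        ((measureReal_localSup_le_sub hμ hsc.le hu0).trans (hb _ hsc (by linarith)))
    _ = 4000000 * σ ^ 4 / s ^ 4 := by ring

/-- If the local width grows fast below `r`, the error exceeds `r / 2` with probability `1 / 2`. -/
theorem half_le_measureReal_lseError {n : ℕ} {K : Set (E n)} (hne : K.Nonempty) (hcl : IsClosed K)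
    (hcv : Convex ℝ K) {μ : E n} (hμ : μ ∈ K) {σ r : ℝ} (hσ : 0 < σ) (hr : 14 * σ ≤ r)
    (hw : r ^ 2 / σ ≤ localWidth K μ r - localWidth K μ (r / 2)) :
    1 / 2 ≤ (stdGaussian (E n)).real {x | r / 2 ≤ lseError K σ μ x} := by
  have hr0 : 0 < r := by linarith
  -- An error below `r/2` would force `σ(Z(r) - Z(r/2)) ≤ 3r²/8`, while without deviations by `u`
  -- this quantity exceeds `r²/2`. With `r ≥ 14σ` each deviation has probability at most `exp(-2) ≤
  -- 1/4`.
  set u := r ^ 2 / (4 * σ) with hu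
  have hu0 : 0 ≤ u := by positivity
  have hsub : {x | r / 2 ≤ lseError K σ μ x}ᶜ ⊆
      {x | localWidth K μ (r / 2) + u ≤ localSup K μ (r / 2) x} ∪
      {x | localSup K μ r x ≤ localWidth K μ r - u} := by
    intro x hx
    simp only [Set.mem_compl_iff, Set.mem_ofPred_eq, not_le] at hx
    have h := localSup_le_of_lseError_le hcl hcv hμ hσ hr0.le (by linarith) hx.le
    by_contra hcon
    simp only [Set.mem_union, Set.mem_ofPred_eq, not_or, not_le] at hcon
    have h1 : r ^ 2 / σ - 2 * u < localSup K μ r x - localSup K μ (r / 2) x := by linarith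
    have h2 := mul_lt_mul_of_pos_left h1 hσ
    have e : σ * (r ^ 2 / σ - 2 * u) = r ^ 2 / 2 := by
      rw [hu]; field_simp; norm_num
    rw [e] at h2
    nlinarith
  have hb : ∀ a, 0 < a → a ≤ r → Real.exp (-u ^ 2 / (6 * a ^ 2)) ≤ 1 / 4 := by
    intro a ha har
    have h1 : 2 ≤ u ^ 2 / (6 * a ^ 2) := by
      have : a ^ 2 ≤ r ^ 2 := by gcongr
      have : (14 * σ) ^ 2 ≤ r ^ 2 := by gcongr
      calc 2 ≤ u ^ 2 / (6 * r ^ 2) := by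
            rw [hu, le_div_iff₀ (by positivity), div_pow, le_div_iff₀ (by positivity)]
            nlinarith [mul_pos hr0 hr0, sq_nonneg σ]
        _ ≤ u ^ 2 / (6 * a ^ 2) := by gcongr
    rw [neg_div]
    refine (Real.exp_le_exp.2 (neg_le_neg h1)).trans ?_
    rw [Real.exp_neg, one_div]
    refine inv_anti₀ (by norm_num) ?_
    have := Real.quadratic_le_exp_of_nonneg (x := 2) (by norm_num)
    linarith
  have hcompl : (stdGaussian (E n)).real {x | r / 2 ≤ lseError K σ μ x}ᶜ ≤ 1 / 2 :=
    calc _ ≤ _ := measureReal_mono hsub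
    _ ≤ _ := measureReal_union_le _ _
    _ ≤ 1 / 4 + 1 / 4 := add_le_add
        ((measureReal_add_le_localSup hμ (by positivity) hu0).trans
          (hb _ (by positivity) (by linarith)))
        ((measureReal_localSup_le_sub hμ hr0.le hu0).trans (hb _ hr0 le_rfl))
    _ = 1 / 2 := by norm_num
  rw [probReal_compl_eq_one_sub (measurableSet_le measurable_const
    (continuous_lseError hne hcl hcv σ μ).measurable)] at hcompl
  linarith

/-! ### Lower bounds from packings. -/

/-- Cauchy-Schwarz against the Cameron-Martin density, whose second moment is `exp(‖h‖²)`. This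
stands in for an information inequality when changing the mean. -/
theorem measureReal_preimage_add_sq_le {n : ℕ} (h : E n) {A : Set (E n)} (hA : MeasurableSet A) :
    (stdGaussian (E n)).real ((fun x => x + h) ⁻¹' A) ^ 2
      ≤ Real.exp (‖h‖ ^ 2) * (stdGaussian (E n)).real A := by
  set γ := stdGaussian (E n) with hγ
  set f : E n → ℝ≥0∞ := fun x => ENNReal.ofReal (Real.exp (inner ℝ h x - ‖h‖ ^ 2 / 2)) with hf
  have hfm : Measurable f := by fun_prop
  have hgm : Measurable (A.indicator (1 : E n → ℝ≥0∞)) := measurable_one.indicator hA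
  have h1 : γ ((fun x => x + h) ⁻¹' A) = ∫⁻ x, (f * A.indicator (1 : E n → ℝ≥0∞)) x ∂γ := by
    rw [← lintegral_indicator_one (measurable_add_const h hA)]
    exact lintegral_add_right_stdGaussian h hgm
  have hf2 : ∫⁻ x, f x ^ (2 : ℝ) ∂γ = ENNReal.ofReal (Real.exp (‖h‖ ^ 2)) := by
    have e : ∀ x, f x ^ (2 : ℝ) = ENNReal.ofReal (Real.exp (-‖h‖ ^ 2)) *
        ENNReal.ofReal (Real.exp (innerSL ℝ ((2 : ℝ) • h) x)) := by
      intro x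
      rw [hf, ENNReal.rpow_two, ← ENNReal.ofReal_pow (Real.exp_pos _).le, ← Real.exp_nat_mul,
        ← ENNReal.ofReal_mul (Real.exp_pos _).le, ← Real.exp_add, innerSL_apply_apply,
        real_inner_smul_left]
      congr 2
      push_cast
      ring
    simp_rw [e]
    rw [lintegral_const_mul _ (by fun_prop), lintegral_exp_dual,
      ← ENNReal.ofReal_mul (Real.exp_pos _).le, ← Real.exp_add, innerSL_apply_norm, norm_smul]
    congr 2
    norm_num
    ring
  have hg2 : ∫⁻ x, A.indicator (1 : E n → ℝ≥0∞) x ^ (2 : ℝ) ∂γ = γ A := by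
    rw [← lintegral_indicator_one hA]
    refine lintegral_congr fun x => ?_
    by_cases hx : x ∈ A <;> simp [hx]
  have h2 := ENNReal.lintegral_mul_le_Lp_mul_Lq γ Real.HolderConjugate.two_two hfm.aemeasurable
    hgm.aemeasurable
  rw [← h1, hf2, hg2, ← ENNReal.mul_rpow_of_nonneg _ _ (by norm_num)] at h2
  have h3 : γ ((fun x => x + h) ⁻¹' A) ^ 2 ≤ ENNReal.ofReal (Real.exp (‖h‖ ^ 2)) * γ A := by
    refine (pow_le_pow_left' h2 2).trans (le_of_eq ?_)
    rw [← ENNReal.rpow_natCast, ← ENNReal.rpow_mul]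
    norm_num
  rw [← ofReal_measureReal, ← ofReal_measureReal, ← ENNReal.ofReal_mul (Real.exp_pos _).le,
    ← ENNReal.ofReal_pow measureReal_nonneg, ENNReal.ofReal_le_ofReal_iff (by positivity)] at h3
  exact h3

/-- Among `2η`-separated means that are close to `θ` in the scale of the noise, one is hard to
recover up to `η`. -/
theorem exists_measureReal_lseError_lt_le {n : ℕ} {K : Set (E n)} (hne : K.Nonempty)
    (hcl : IsClosed K) (hcv : Convex ℝ K) {σ η ρ q : ℝ} (hσ : 0 < σ) (hq : 0 ≤ q) {θ : E n}
    {S : Finset (E n)} (hS : S.Nonempty)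
    (hsep : ∀ a ∈ S, ∀ b ∈ S, a ≠ b → 2 * η ≤ ‖a - b‖) (hρ : ∀ a ∈ S, ‖a - θ‖ ≤ ρ)
    (hcard : Real.exp ((ρ / σ) ^ 2) ≤ q ^ 2 * S.card) :
    ∃ a ∈ S, (stdGaussian (E n)).real {x | lseError K σ a x < η} ≤ q := by
  set γ := stdGaussian (E n) with hγ
  set A : E n → Set (E n) := fun a => {x | ‖lse K (θ + σ • x) - a‖ < η} with hA
  have hc : Continuous (lse K) := (lipschitzWith_lse hne hcl hcv).continuous
  have hAm : ∀ a, MeasurableSet (A a) := fun a =>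
    measurableSet_lt (by fun_prop : Continuous fun x => ‖lse K (θ + σ • x) - a‖).measurable
      measurable_const
  have hdisj : Set.PairwiseDisjoint (↑S) A := by
    intro a ha b hb hab
    refine Set.disjoint_left.2 fun x hxa hxb => ?_
    have h1 := hsep a ha b hb hab
    have h2 := norm_sub_le_norm_sub_add_norm_sub a (lse K (θ + σ • x)) b
    rw [norm_sub_rev a (lse K (θ + σ • x))] at h2
    have h3 : ‖lse K (θ + σ • x) - a‖ < η := hxa
    have h4 : ‖lse K (θ + σ • x) - b‖ < η := hxb
    linarith
  -- Under the single mean `θ` the success events are disjoint, so one has probability at most `1 /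
  -- S.card`; the shift by `(a - θ)/σ` carries this to the mean `a`.
  have hsum : ∑ a ∈ S, γ.real (A a) ≤ 1 := by
    rw [← measureReal_biUnion_finset hdisj fun a _ => hAm a]
    exact measureReal_le_one
  have hc0 : (0 : ℝ) < S.card := by exact_mod_cast Finset.card_pos.2 hS
  obtain ⟨a, ha, hle⟩ : ∃ a ∈ S, γ.real (A a) ≤ 1 / S.card := by
    refine Finset.exists_le_of_sum_le hS (hsum.trans (le_of_eq ?_))
    rw [Finset.sum_const, nsmul_eq_mul]
    field_simp
  refine ⟨a, ha, ?_⟩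
  have e : {x | lseError K σ a x < η} = (fun x => x + σ⁻¹ • (a - θ)) ⁻¹' A a := by
    ext x
    have : θ + σ • (x + σ⁻¹ • (a - θ)) = a + σ • x := by
      rw [smul_add, smul_inv_smul₀ hσ.ne']
      abel
    simp only [hA, Set.preimage_ofPred_eq, Set.mem_ofPred_eq, this]
    rfl
  have h1 := measureReal_preimage_add_sq_le (σ⁻¹ • (a - θ)) (hAm a)
  rw [← e] at h1
  have h2 : ‖σ⁻¹ • (a - θ)‖ ≤ ρ / σ := by
    rw [norm_smul, norm_inv, Real.norm_of_nonneg hσ.le, inv_mul_eq_div]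
    gcongr
    exact hρ a ha
  refine abs_le_of_sq_le_sq' ?_ hq |>.2
  calc γ.real {x | lseError K σ a x < η} ^ 2
      ≤ Real.exp (‖σ⁻¹ • (a - θ)‖ ^ 2) * γ.real (A a) := h1
    _ ≤ q ^ 2 * S.card * (1 / S.card) := by
        refine mul_le_mul (le_trans (Real.exp_le_exp.2 ?_) hcard) hle measureReal_nonneg
          (by positivity)
        gcongr
    _ = q ^ 2 := by field_simp

/-- A packing lower bound for the worst case rate of the least squares estimator. -/
theorem le_worstRate_of_packing {n : ℕ} {K : Set (E n)} (hcl : IsClosed K) (hcv : Convex ℝ K)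
    {σ η ρ q a : ℝ} (hσ : 0 < σ) (hq : 0 ≤ q) (ha : 0 ≤ a) (haq : a ^ 2 ≤ 1 - q) {θ : E n}
    {S : Finset (E n)} (hS : S.Nonempty) (hSK : ↑S ⊆ K)
    (hsep : ∀ a ∈ S, ∀ b ∈ S, a ≠ b → 2 * η ≤ ‖a - b‖) (hρ : ∀ a ∈ S, ‖a - θ‖ ≤ ρ)
    (hcard : Real.exp ((ρ / σ) ^ 2) ≤ q ^ 2 * S.card) :
    ENNReal.ofReal (a * η) ≤ worstRate K σ := by
  have hne : K.Nonempty := hS.imp fun a ha => hSK ha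
  obtain ⟨μ, hμ, h⟩ := exists_measureReal_lseError_lt_le hne hcl hcv hσ hq hS hsep hρ hcard
  refine le_worstRate hne hcl hcv (hSK hμ) ha ?_
  have h1 := probReal_compl_eq_one_sub (μ := stdGaussian (E n)) (measurableSet_le measurable_const
    (continuous_lseError hne hcl hcv σ μ).measurable : MeasurableSet {x | η ≤ lseError K σ μ x})
  have h2 : {x | η ≤ lseError K σ μ x}ᶜ = {x | lseError K σ μ x < η} := by
    ext x; simp
  rw [h2] at h1
  linarith

/-! ### Local packing numbers. -/

theorem toNNReal_lt_edist_iff {n : ℕ} {r : ℝ} (hr : 0 ≤ r) {a b : E n} :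
    ((r.toNNReal : ℝ≥0) : ℝ≥0∞) < edist a b ↔ r < ‖a - b‖ := by
  rw [edist_dist, dist_eq_norm]
  exact ENNReal.ofReal_lt_ofReal_iff_of_nonneg hr

/-- The bound must be uniform in `θ`: a finite cover of the ball about the origin at half the scale
is translated to every centre. -/
theorem locPacking_ne_top {n : ℕ} (K : Set (E n)) {c e : ℝ} (hc : 0 < c) (he : 0 < e) :
    locPacking K c e ≠ ⊤ := by
  set δ := (e / c).toNNReal with hδ
  have hδ0 : δ / 2 ≠ 0 := by
    have : 0 < δ := Real.toNNReal_pos.2 (by positivity)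
    positivity
  obtain ⟨N, -, hNf, hN⟩ := Metric.exists_finite_isCover_of_isCompact hδ0
    (isCompact_closedBall (0 : E n) e)
  suffices locPacking K c e ≤ N.encard from
    ne_top_of_le_ne_top (Set.encard_ne_top_iff.2 hNf) this
  refine iSup₂_le fun θ _ => ?_
  rw [← hδ, show δ = 2 * (δ / 2) by field_simp]
  refine (Metric.packingNumber_two_mul_le_externalCoveringNumber _ _).trans ?_
  refine (Metric.externalCoveringNumber_mono_set Set.inter_subset_left).trans ?_
  have hiso : Isometry (fun x : E n => x + θ) := isometry_add_right θ
  have hcov := (hiso.isCover_image_iff N).2 hN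
  have him : (fun x : E n => x + θ) '' Metric.closedBall 0 e = Metric.closedBall θ e := by
    ext y
    simp only [Set.mem_image, mem_closedBall_iff_norm, sub_zero]
    exact ⟨by rintro ⟨x, hx, rfl⟩; simpa using hx, fun hy => ⟨y - θ, hy, by simp⟩⟩
  rw [him] at hcov
  exact hcov.externalCoveringNumber_le_encard.trans (Set.encard_image_le _ _)

theorem exists_locPacking {n : ℕ} {K : Set (E n)} (hne : K.Nonempty) {c e : ℝ} (hc : 0 < c)
    (he : 0 < e) : ∃ θ ∈ K, ∃ S : Finset (E n), S.Nonempty ∧ ↑S ⊆ Metric.closedBall θ e ∩ K ∧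
      (∀ a ∈ S, ∀ b ∈ S, a ≠ b → e / c < ‖a - b‖) ∧ locEntropy K c e = Real.log S.card := by
  have : Nonempty K := hne.to_subtype
  have htop := locPacking_ne_top K hc he
  have h0 : locPacking K c e = ⨆ θ : K, Metric.packingNumber (e / c).toNNReal
      (Metric.closedBall (θ : E n) e ∩ K) := by rw [locPacking, iSup_subtype']
  -- A finite supremum of extended naturals is attained.
  obtain ⟨θ, hθ⟩ := ENat.exists_eq_iSup_of_lt_top (h0 ▸ lt_top_iff_ne_top.2 htop)
  rw [← h0] at hθ
  obtain ⟨C, hC, hCf, hCs, hCe⟩ := Metric.exists_set_encard_eq_packingNumber (hθ ▸ htop)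
  have hcard : (locPacking K c e).toNat = hCf.toFinset.card := by
    rw [← hθ, ← hCe, hCf.encard_eq_coe_toFinset_card, ENat.toNat_natCast]
  refine ⟨θ, θ.2, hCf.toFinset, ?_, by simpa using hC, ?_, by rw [locEntropy, hcard]⟩
  · rw [← Finset.card_pos, ← hcard, Nat.pos_iff_ne_zero]
    have : 0 < locPacking K c e := by
      rw [← hθ, Metric.packingNumber_pos_iff]
      exact nonempty_closedBall_inter θ.2 he.le
    simp [this.ne', htop]
  · intro a ha b hb hab
    exact (toNNReal_lt_edist_iff (by positivity)).1
      (hCs (by simpa using ha) (by simpa using hb) hab)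

theorem card_le_locPacking {n : ℕ} {K : Set (E n)} {c e : ℝ} (hc : 0 < c) (he : 0 < e) {μ : E n}
    (hμ : μ ∈ K) {S : Finset (E n)} (hS : ↑S ⊆ Metric.closedBall μ e ∩ K)
    (hsep : ∀ a ∈ S, ∀ b ∈ S, a ≠ b → e / c < ‖a - b‖) :
    (S.card : ℝ) ≤ (locPacking K c e).toNat := by
  have h1 : (S : Set (E n)).encard ≤ locPacking K c e := by
    refine le_trans (Metric.IsSeparated.encard_le_packingNumber hS ?_) (le_iSup₂
      (f := fun θ (_ : θ ∈ K) => Metric.packingNumber (e / c).toNNReal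
        (Metric.closedBall θ e ∩ K)) μ hμ)
    intro a ha b hb hab
    exact (toNNReal_lt_edist_iff (by positivity)).2 (hsep a ha b hb hab)
  rw [Set.encard_coe_eq_coe_finsetCard] at h1
  have h2 := ENat.toNat_le_toNat h1 (locPacking_ne_top K hc he)
  rw [ENat.toNat_natCast] at h2
  exact_mod_cast h2

theorem exists_localCover {n : ℕ} {K : Set (E n)} {c e : ℝ} (hc : 0 < c) (he : 0 < e) {μ : E n}
    (hμ : μ ∈ K) : ∃ N : Finset (E n), ↑N ⊆ Metric.closedBall μ e ∩ K ∧
      (∀ t ∈ Metric.closedBall μ e ∩ K, ∃ ν ∈ N, ‖t - ν‖ ≤ e / c) ∧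
      (N.card : ℝ) ≤ (locPacking K c e).toNat := by
  set δ := (e / c).toNNReal with hδ
  set T := Metric.closedBall μ e ∩ K with hT
  have htop : Metric.packingNumber δ T ≠ ⊤ :=
    ne_top_of_le_ne_top (locPacking_ne_top K hc he)
      (le_iSup₂ (f := fun θ (_ : θ ∈ K) => Metric.packingNumber δ (Metric.closedBall θ e ∩ K)) μ hμ)
  have hcov := Metric.isCover_maximalSeparatedSet htop
  have hfin : (Metric.maximalSeparatedSet δ T).Finite := by
    rw [← Set.encard_ne_top_iff, Metric.encard_maximalSeparatedSet htop]
    exact htop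
  have hsub : ↑hfin.toFinset ⊆ T := by simpa using Metric.maximalSeparatedSet_subset
  refine ⟨hfin.toFinset, hsub, ?_, card_le_locPacking hc he hμ hsub ?_⟩
  · intro t ht
    obtain ⟨ν, hν, h⟩ := hcov ht
    refine ⟨ν, by simpa using hν, ?_⟩
    by_contra! hlt
    exact absurd h (not_le.2 ((toNNReal_lt_edist_iff (by positivity)).2 hlt))
  · intro a ha b hb hab
    exact (toNNReal_lt_edist_iff (by positivity)).1
      (Metric.isSeparated_maximalSeparatedSet (by simpa using ha) (by simpa using hb) hab)

theorem log_two_le_locEntropy {n : ℕ} {K : Set (E n)} {c e : ℝ} (hc : 0 < c) (he : 0 < e)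
    {p q : E n} (hp : p ∈ K) (hq : q ∈ K) (h1 : e / c < ‖p - q‖) (h2 : ‖p - q‖ ≤ e) :
    Real.log 2 ≤ locEntropy K c e := by
  have hpq : p ≠ q := by
    rintro rfl
    rw [sub_self, norm_zero] at h1
    exact absurd h1 (not_lt.2 (by positivity))
  have h := card_le_locPacking (S := {p, q}) hc he hp ?_ ?_
  · rw [Finset.card_pair hpq] at h
    exact Real.log_le_log (by norm_num) (by exact_mod_cast h)
  · intro x hx
    rw [Finset.coe_pair] at hx
    rcases hx with rfl | rfl
    · exact ⟨Metric.mem_closedBall_self he.le, hp⟩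
    · exact ⟨by rwa [mem_closedBall_iff_norm, norm_sub_rev], hq⟩
  · intro a ha b hb hab
    simp only [Finset.mem_insert, Finset.mem_singleton] at ha hb
    rcases ha with rfl | rfl <;> rcases hb with rfl | rfl
    · exact absurd rfl hab
    · exact h1
    · rwa [norm_sub_rev]
    · exact absurd rfl hab

/-! ### The upper bound. -/

theorem rescaledNoise_pos {c σ : ℝ} (hc : 2 < c) (hσ : 0 < σ) : 0 < rescaledNoise c σ := by
  have h1 : 4 / c ^ 2 < 1 := by
    rw [div_lt_one (by positivity)]
    nlinarith
  exact div_pos (by positivity) (by linarith)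

/-- The reason for the form of `σ'`: it turns the slope of the Lipschitz condition into the growth
threshold of `measureReal_le_lseError`. -/
theorem div_rescaledNoise {c σ : ℝ} (hc : 2 < c) (hσ : 0 < σ) (s : ℝ) :
    (1 + 2 / c) * s / rescaledNoise c σ = s * (1 - 4 / c ^ 2) / (4 * σ) := by
  have h1 : 4 / c ^ 2 < 1 := by
    rw [div_lt_one (by positivity)]
    nlinarith
  have h2 : 0 < 1 + 2 / c := by positivity
  have h3 : 0 < 1 - 4 / c ^ 2 := by linarith
  rw [rescaledNoise]
  generalize 1 + 2 / c = u at *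
  generalize 1 - 4 / c ^ 2 = v at *
  field_simp

/-- Outside of the Lipschitz radii the local width grows slowly. -/
theorem localWidth_sub_le_of_notMem {n : ℕ} {K : Set (E n)} {c L τ s : ℝ} (hc : 2 < c)
    (hL : 7 * c ≤ L) (hs : 0 < s) (hτ : 0 < τ) (h : s ∉ lipschitzRadii K c L τ) {μ : E n}
    (hμ : μ ∈ K) :
    localWidth K μ s - localWidth K μ (s / c) ≤ (1 + 2 / c) * s ^ 2 / τ := by
  have hc0 : 0 < c := by linarith
  have hr : 0 ≤ s / c := by positivity
  by_cases hex : ∃ ν ∈ K, ν ≠ μ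
  · set H := √(locEntropy K c s) with hH
    set k := (1 + 2 / c) * s / τ - L / c * H with hk
    have hlt : ∀ ν₁ ∈ K, ∀ ν₂ ∈ K, ν₁ ≠ ν₂ →
        localWidth K ν₁ (s / c) - localWidth K ν₂ (s / c) < k * ‖ν₁ - ν₂‖ := by
      intro ν₁ h₁ ν₂ h₂ hne
      by_contra! hcon
      refine h ⟨hs, ν₁, h₁, ν₂, h₂, hne, ?_⟩
      have e : (1 + 2 / c) * s * ‖ν₁ - ν₂‖ / τ = (1 + 2 / c) * s / τ * ‖ν₁ - ν₂‖ := by ring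
      rw [e, ← hH]
      rw [hk] at hcon
      linarith
    -- The condition fails for both orders of a pair, and adding the two strict inequalities gives
    -- `0 < 2k‖ν - μ‖`.
    have hk0 : 0 ≤ k := by
      obtain ⟨ν, hν, hne⟩ := hex
      have h1 := hlt ν hν μ hμ hne
      have h2 := hlt μ hμ ν hν hne.symm
      rw [norm_sub_rev] at h2
      by_contra! hneg
      have := mul_nonpos_of_nonpos_of_nonneg hneg.le (norm_nonneg (ν - μ))
      linarith
    obtain ⟨N, hN, hcov, hcard⟩ := exists_localCover (K := K) hc0 hs hμ
    have hrs : s / c ≤ s := div_le_self hs.le (by linarith)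
    have hm : ∀ ν ∈ N, localWidth K ν (s / c) ≤ localWidth K μ (s / c) + k * s := by
      intro ν hν
      rcases eq_or_ne ν μ with rfl | hne
      · have := mul_nonneg hk0 hs.le
        linarith
      · have h1 := hlt ν (hN hν).2 μ hμ hne
        have h2 := mul_le_mul_of_nonneg_left (mem_closedBall_iff_norm.1 (hN hν).1) hk0
        linarith
    have hmain := localWidth_le_of_cover hμ hs hr hrs hN hcov hm hcard
    have hent : √(Real.log ((locPacking K c s).toNat : ℝ)) = H := rfl
    rw [hent] at hmain
    have hLc : 7 ≤ L / c := (le_div_iff₀ hc0).2 hL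
    have hH0 : 0 ≤ s * H := mul_nonneg hs.le (Real.sqrt_nonneg _)
    have h3 := mul_le_mul_of_nonneg_right hLc hH0
    have e : k * s = (1 + 2 / c) * s ^ 2 / τ - L / c * (s * H) := by rw [hk]; ring
    rw [e] at hmain
    linarith
  -- A one-point `K` has no pairs of distinct points, so the radii carry no information; its widths
  -- do not grow at all.
  · push Not at hex
    have hK : ∀ r : ℝ, 0 ≤ r → Metric.closedBall μ r ∩ K = {μ} := fun r hr =>
      Set.Subset.antisymm (fun t ht => hex t ht.2)
        (by rintro _ rfl; exact ⟨Metric.mem_closedBall_self hr, hμ⟩)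
    rw [localWidth, localWidth, hK s hs.le, hK _ hr, sub_self]
    positivity

theorem worstRate_le_lipschitzRate_add {n : ℕ} {K : Set (E n)} (hne : K.Nonempty)
    (hcl : IsClosed K) (hcv : Convex ℝ K) {c L σ e : ℝ} (hc : 2 < c) (hL : 7 * c ≤ L) (hσ : 0 < σ)
    (he : 0 ≤ e) (h : lipschitzRate K c L (rescaledNoise c σ) ≤ ENNReal.ofReal e) :
    worstRate K σ ≤ ENNReal.ofReal (5000 * (e + σ)) := by
  refine worstRate_le fun μ hμ => ?_
  have hs₀ : 0 < e + σ := by linarith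
  refine (lintegral_sq_le_of_tail (continuous_lseError hne hcl hcv σ μ).measurable hs₀
    (C := 4000000) (by norm_num) fun s hs => ?_).trans ?_
  · have hs0 : 0 < s := by linarith
    have hnot : s ∉ lipschitzRadii K c L (rescaledNoise c σ) := by
      intro hmem
      have h1 : ENNReal.ofReal s ≤ lipschitzRate K c L (rescaledNoise c σ) :=
        le_iSup₂ (f := fun ε (_ : ε ∈ lipschitzRadii K c L (rescaledNoise c σ)) =>
          ENNReal.ofReal ε) s hmem
      have := (ENNReal.ofReal_le_ofReal_iff he).1 (h1.trans h)
      linarith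
    have hw := localWidth_sub_le_of_notMem hc hL hs0 (rescaledNoise_pos hc hσ) hnot hμ
    rw [div_rescaledNoise hc hσ] at hw
    refine (measureReal_le_lseError hcl hcv hμ hσ hc hs0 hw).trans ?_
    gcongr
    linarith
  · rw [← ENNReal.ofReal_pow (by positivity)]
    refine ENNReal.ofReal_le_ofReal ?_
    -- The constant `5000` is chosen with `1 + 6 · 4000000 ≤ 5000²`.
    nlinarith [sq_nonneg (e + σ)]

theorem exists_norm_sub_eq {n : ℕ} {K : Set (E n)} (hcv : Convex ℝ K) {ε : ℝ} (hε : 0 ≤ ε)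
    (h : ENNReal.ofReal ε < Metric.ediam K) : ∃ p ∈ K, ∃ q ∈ K, ‖p - q‖ = ε := by
  obtain ⟨p, hp, q, hq, hpq⟩ : ∃ p ∈ K, ∃ q ∈ K, ε < ‖p - q‖ := by
    by_contra! hcon
    refine absurd (Metric.ediam_le fun p hp q hq => ?_) (not_le.2 h)
    rw [edist_dist, dist_eq_norm]
    exact ENNReal.ofReal_le_ofReal (hcon p hp q hq)
  have hpos : 0 < ‖p - q‖ := hε.trans_lt hpq
  have hl : ε / ‖p - q‖ ≤ 1 := (div_le_one hpos).2 hpq.le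
  refine ⟨p, hp, (1 - ε / ‖p - q‖) • p + (ε / ‖p - q‖) • q,
    hcv hp hq (by linarith) (by positivity) (by ring), ?_⟩
  have e : p - ((1 - ε / ‖p - q‖) • p + (ε / ‖p - q‖) • q) = (ε / ‖p - q‖) • (p - q) := by module
  rw [e, norm_smul, Real.norm_of_nonneg (by positivity)]
  field_simp

/-- Every positive `ε < min(σ, d)` is a Lipschitz radius. By convexity `K` has two points at
distance exactly `ε`, which can be ordered to make the width difference nonnegative. They give
entropy at least `log 2`, so the entropy coefficient is at least `7/2`, against a slope of at most
`1/4`. -/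
theorem min_le_lipschitzRate {n : ℕ} {K : Set (E n)} (hcv : Convex ℝ K) {c L σ : ℝ} (hc : 2 < c)
    (hL : 7 * c ≤ L) (hσ : 0 < σ) :
    min (ENNReal.ofReal σ) (Metric.ediam K) ≤ lipschitzRate K c L (rescaledNoise c σ) := by
  refine le_of_forall_lt fun x hx => ?_
  obtain ⟨y, hxy, hy⟩ := exists_between hx
  have hytop : y ≠ ⊤ := ne_top_of_lt hy
  refine hxy.trans_le ?_
  set ε := y.toReal with hεdef
  have hyε : ENNReal.ofReal ε = y := ENNReal.ofReal_toReal hytop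
  have hε : 0 < ε := ENNReal.toReal_pos (pos_of_gt hxy).ne' hytop
  rw [← hyε, lt_min_iff] at hy
  have hεσ : ε < σ := (ENNReal.ofReal_lt_ofReal_iff hσ).1 hy.1
  have hc0 : 0 < c := by linarith
  have hτ := rescaledNoise_pos hc hσ
  obtain ⟨p, hp, q, hq, hpq⟩ := exists_norm_sub_eq hcv hε.le hy.2
  have hent := log_two_le_locEntropy hc0 hε hp hq
    (by rw [hpq]; exact div_lt_self hε (by linarith)) hpq.le
  have hsq : 1 / 2 ≤ √(locEntropy K c ε) := by
    refine Real.le_sqrt_of_sq_le (le_trans ?_ hent)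
    have := Real.log_two_gt_d9
    linarith
  have hne : p ≠ q := by
    rintro rfl
    rw [sub_self, norm_zero] at hpq
    exact hε.ne hpq
  have key : ∀ a ∈ K, ∀ b ∈ K, a ≠ b → ‖a - b‖ = ε →
      localWidth K b (ε / c) ≤ localWidth K a (ε / c) →
      ε ∈ lipschitzRadii K c L (rescaledNoise c σ) := by
    intro a ha b hb hab habε hw
    refine ⟨hε, a, ha, b, hb, hab, ?_⟩
    have h1 : (1 + 2 / c) * ε * ‖a - b‖ / rescaledNoise c σ ≤ ‖a - b‖ * (1 / 4) := by
      have e : (1 + 2 / c) * ε * ‖a - b‖ / rescaledNoise c σ =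
          ‖a - b‖ * ((1 + 2 / c) * ε / rescaledNoise c σ) := by ring
      rw [e, div_rescaledNoise hc hσ]
      refine mul_le_mul_of_nonneg_left ?_ (norm_nonneg _)
      rw [div_le_div_iff₀ (by positivity) (by norm_num)]
      have : 0 ≤ 4 / c ^ 2 := by positivity
      nlinarith
    have h2 : ‖a - b‖ * (1 / 4) ≤ L / c * ‖a - b‖ * √(locEntropy K c ε) := by
      have hLc : 7 ≤ L / c := (le_div_iff₀ hc0).2 hL
      have : (7 : ℝ) * (1 / 2) ≤ L / c * √(locEntropy K c ε) := by gcongr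
      have := mul_le_mul_of_nonneg_left this (norm_nonneg (a - b))
      have h0 := norm_nonneg (a - b)
      linarith
    linarith
  have hmem : ε ∈ lipschitzRadii K c L (rescaledNoise c σ) := by
    rcases le_total (localWidth K q (ε / c)) (localWidth K p (ε / c)) with h | h
    · exact key p hp q hq hne hpq h
    · exact key q hq p hp hne.symm (by rwa [norm_sub_rev]) h
  rw [← hyε]
  exact le_iSup₂ (f := fun ε (_ : ε ∈ lipschitzRadii K c L (rescaledNoise c σ)) =>
    ENNReal.ofReal ε) ε hmem

theorem worstRate_le_mul_lipschitzRate {n : ℕ} {K : Set (E n)} (hne : K.Nonempty)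
    (hcl : IsClosed K) (hcv : Convex ℝ K) {c L σ : ℝ} (hc : 2 < c) (hL : 7 * c ≤ L) (hσ : 0 < σ) :
    worstRate K σ ≤ 10000 * lipschitzRate K c L (rescaledNoise c σ) := by
  set R := lipschitzRate K c L (rescaledNoise c σ) with hR
  rcases eq_or_ne R ⊤ with htop | htop
  · rw [htop, ENNReal.mul_top (by norm_num)]
    exact le_top
  have hmin := min_le_lipschitzRate hcv hc hL hσ
  rw [← hR] at hmin
  rcases le_total (ENNReal.ofReal σ) (Metric.ediam K) with h | h
  · rw [min_eq_left h] at hmin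
    have hRe : ENNReal.ofReal R.toReal = R := ENNReal.ofReal_toReal htop
    have hle := worstRate_le_lipschitzRate_add hne hcl hcv hc hL hσ ENNReal.toReal_nonneg hRe.ge
    refine hle.trans ?_
    have hσR : σ ≤ R.toReal := (ENNReal.ofReal_le_iff_le_toReal htop).1 hmin
    calc ENNReal.ofReal (5000 * (R.toReal + σ)) ≤ ENNReal.ofReal (10000 * R.toReal) :=
          ENNReal.ofReal_le_ofReal (by linarith)
      _ = 10000 * R := by
          rw [ENNReal.ofReal_mul (by norm_num), hRe]
          norm_num
  · rw [min_eq_right h] at hmin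
    refine (worstRate_le_ediam hne hcl hcv σ).trans (hmin.trans ?_)
    exact le_mul_of_one_le_left' (by norm_num)

/-! ### The lower bound at large Lipschitz radii. -/

/-- A large local entropy forces a large worst case rate. -/
theorem le_worstRate_of_le_locEntropy {n : ℕ} {K : Set (E n)} (hne : K.Nonempty)
    (hcl : IsClosed K) (hcv : Convex ℝ K) {c σ ε l : ℝ} (hc : 0 < c) (hσ : 0 < σ) (hε : 0 < ε)
    (hl0 : 0 < l) (hl1 : l ≤ 1) (hlε : σ ≤ l * ε)
    (h : 4 * (l * ε / σ) ^ 2 ≤ locEntropy K c ε) :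
    ENNReal.ofReal (l * ε / (4 * c)) ≤ worstRate K σ := by
  obtain ⟨θ, hθ, S, hSne, hS, hsep, hent⟩ := exists_locPacking hne hc hε
  -- Contracting the packing towards `θ` stays in `K` and keeps its cardinality, while its radius in
  -- noise units drops to the square root of a quarter of the entropy or less.
  set f : E n → E n := fun t => (1 - l) • θ + l • t with hf
  have hsub : ∀ a b, f a - f b = l • (a - b) := fun a b => by simp only [hf]; module
  have hsubθ : ∀ a, f a - θ = l • (a - θ) := fun a => by simp only [hf]; module
  have hinj : Function.Injective f := by
    intro a b hab
    have := hsub a b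
    rw [hab, sub_self, eq_comm, smul_eq_zero, sub_eq_zero] at this
    exact this.resolve_left hl0.ne'
  have hcard : (0 : ℝ) < S.card := by exact_mod_cast Finset.card_pos.2 hSne
  classical
  have key := le_worstRate_of_packing hcl hcv (η := l * ε / (2 * c)) (ρ := l * ε) (q := 1 / 2)
    (a := 1 / 2) hσ (by norm_num) (by norm_num) (by norm_num) (θ := θ) (S := S.image f)
    (hSne.image f) ?_ ?_ ?_ ?_
  · refine le_trans (le_of_eq ?_) key
    congr 1
    field_simp
    norm_num
  · intro x hx
    obtain ⟨t, ht, rfl⟩ := Finset.mem_image.1 (Finset.mem_coe.1 hx)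
    exact hcv hθ (hS ht).2 (by linarith) hl0.le (by ring)
  · intro x hx y hy hxy
    obtain ⟨a, ha, rfl⟩ := Finset.mem_image.1 hx
    obtain ⟨b, hb, rfl⟩ := Finset.mem_image.1 hy
    have h1 := hsep a ha b hb fun hab => hxy (by rw [hab])
    rw [hsub, norm_smul, Real.norm_of_nonneg hl0.le]
    have h2 := mul_le_mul_of_nonneg_left h1.le hl0.le
    refine le_trans (le_of_eq ?_) h2
    field_simp
  · intro x hx
    obtain ⟨a, ha, rfl⟩ := Finset.mem_image.1 hx
    rw [hsubθ, norm_smul, Real.norm_of_nonneg hl0.le]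
    exact mul_le_mul_of_nonneg_left (mem_closedBall_iff_norm.1 (hS ha).1) hl0.le
  · rw [Finset.card_image_of_injective _ hinj, ← Real.exp_log hcard, ← hent]
    set y := (l * ε / σ) ^ 2 with hy
    have hy1 : 1 ≤ y := by
      rw [hy]
      exact one_le_pow₀ ((one_le_div hσ).2 hlε)
    have h1 : Real.exp (4 * y) ≤ Real.exp (locEntropy K c ε) := Real.exp_le_exp.2 h
    have h2 : Real.exp (4 * y) = Real.exp y * Real.exp (3 * y) := by
      rw [← Real.exp_add]; congr 1; ring
    have h3 : 4 ≤ Real.exp (3 * y) := by linarith [Real.add_one_le_exp (3 * y)]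
    have := mul_le_mul_of_nonneg_left h3 (Real.exp_pos y).le
    linarith

/-- A large increment of the local width between two points forces a large worst case rate. -/
theorem le_worstRate_of_le_localWidth_sub {n : ℕ} {K : Set (E n)}
    (hcl : IsClosed K) (hcv : Convex ℝ K) {σ r : ℝ} (hσ : 0 < σ) (hr : 14 * σ ≤ r)
    {ν₁ ν₂ : E n} (h₁ : ν₁ ∈ K) (h₂ : ν₂ ∈ K) (hne : ν₁ ≠ ν₂)
    (h : 2 * r / σ * ‖ν₁ - ν₂‖ ≤ localWidth K ν₁ r - localWidth K ν₂ r) :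
    ENNReal.ofReal (r / 4) ≤ worstRate K σ := by
  have hr0 : 0 < r := by linarith
  set δ := ‖ν₁ - ν₂‖ with hδ
  have hδ0 : 0 < δ := norm_pos_iff.2 (sub_ne_zero.2 hne)
  have h3 := localWidth_le_localWidth_add h₁ h₂ hr0.le
  have hl1 : r / 2 / (r / 2 + δ) ≤ 1 := (div_le_one (by positivity)).2 (by linarith)
  -- The weight places `r` between `r/2` and `r + δ`. The ball about `ν₁` lies in the ball of radius
  -- `r + δ` about `ν₂`, so the increment beyond `r` is large, and concavity makes the one from
  -- `r/2` to `r` at least as steep.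
  have h4 := localWidth_concave hcv h₂ (a := r / 2) (b := r + δ) (l := r / 2 / (r / 2 + δ))
    (by positivity) (by positivity) (by positivity) hl1
  have e1 : (1 - r / 2 / (r / 2 + δ)) * (r / 2) + r / 2 / (r / 2 + δ) * (r + δ) = r := by
    field_simp
    ring
  have e2 : 1 - r / 2 / (r / 2 + δ) = δ / (r / 2 + δ) := by
    field_simp
    ring
  rw [e1, e2, div_mul_eq_mul_div, div_mul_eq_mul_div, ← add_div, div_le_iff₀ (by positivity)] at h4
  rw [← hδ] at h3
  have h5 : r / 2 * (localWidth K ν₂ r + 2 * r / σ * δ) ≤ r / 2 * localWidth K ν₂ (r + δ) := by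
    gcongr
    linarith
  have h6 : r ^ 2 / σ * δ ≤ (localWidth K ν₂ r - localWidth K ν₂ (r / 2)) * δ := by
    have e : r / 2 * (2 * r / σ * δ) = r ^ 2 / σ * δ := by ring
    nlinarith
  have h7 := half_le_measureReal_lseError ⟨ν₂, h₂⟩ hcl hcv h₂ hσ hr (le_of_mul_le_mul_right h6 hδ0)
  have h8 := le_worstRate ⟨ν₂, h₂⟩ hcl hcv h₂ (a := 1 / 2) (r := r / 2) (σ := σ) (by norm_num)
    (le_trans (by norm_num) h7)
  refine le_trans (le_of_eq ?_) h8
  congr 1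
  ring

theorem le_worstRate_of_mem_lipschitzRadii {n : ℕ} {K : Set (E n)}
    (hcl : IsClosed K) (hcv : Convex ℝ K) {c L σ ε : ℝ} (hc : 2 < c) (hL : 7 * c ≤ L) (hσ : 0 < σ)
    (hε : ε ∈ lipschitzRadii K c L σ) (hB : (14 * c + 4 * L / (c + 2)) * σ ≤ ε) :
    ENNReal.ofReal ((c + 2) / (4 * L) * ε / (4 * c)) ≤ worstRate K σ := by
  obtain ⟨hε0, ν₁, h₁, ν₂, h₂, hne, h⟩ := hε
  have hc0 : 0 < c := by linarith
  have hL0 : 0 < L := by linarith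
  -- Chosen so that `C ε/(2σ) = (L/c) · 2(l ε/σ)`. In the hypothesis on `ε`, the term `4L/(c + 2) =
  -- 1/l` ensures `l ε ≥ σ`, and `14c` ensures `ε/c ≥ 14σ`.
  set l := (c + 2) / (4 * L) with hl
  have hl0 : 0 < l := by positivity
  have hl1 : l ≤ 1 := by rw [hl, div_le_one (by positivity)]; linarith
  set H := √(locEntropy K c ε) with hH
  by_cases hcase : (1 + 2 / c) * ε / (2 * σ) ≤ L / c * H
  · refine le_worstRate_of_le_locEntropy ⟨ν₁, h₁⟩ hcl hcv hc0 hσ hε0 hl0 hl1 ?_ ?_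
    · have h1 : 4 * L / (c + 2) * σ ≤ ε := by
        have : 0 ≤ 14 * c * σ := by positivity
        linarith
      have h2 := mul_le_mul_of_nonneg_left h1 hl0.le
      have e : l * (4 * L / (c + 2) * σ) = σ := by rw [hl]; field_simp
      rwa [e] at h2
    · have h1 : 2 * (l * ε / σ) ≤ H := by
        have e : (1 + 2 / c) * ε / (2 * σ) = L / c * (2 * (l * ε / σ)) := by
          rw [hl]; field_simp; norm_num
        rw [e] at hcase
        exact le_of_mul_le_mul_left hcase (by positivity)
      have h2 : 0 < 2 * (l * ε / σ) := by positivity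
      have h3 : 0 < locEntropy K c ε := Real.sqrt_pos.1 (h2.trans_le h1)
      calc 4 * (l * ε / σ) ^ 2 = (2 * (l * ε / σ)) ^ 2 := by ring
        _ ≤ H ^ 2 := by gcongr
        _ = locEntropy K c ε := Real.sq_sqrt h3.le
  · push Not at hcase
    have hr : 14 * σ ≤ ε / c := by
      rw [le_div_iff₀ hc0]
      have : 0 ≤ 4 * L / (c + 2) * σ := by positivity
      linarith
    refine le_trans (ENNReal.ofReal_le_ofReal ?_)
      (le_worstRate_of_le_localWidth_sub hcl hcv hσ hr h₁ h₂ hne ?_)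
    · rw [div_div, mul_comm c 4]
      gcongr
      exact mul_le_of_le_one_left hε0.le hl1
    · have hδ : 0 ≤ ‖ν₁ - ν₂‖ := norm_nonneg _
      have h3 := mul_le_mul_of_nonneg_right hcase.le hδ
      have e1 : (1 + 2 / c) * ε * ‖ν₁ - ν₂‖ / σ = 2 * ((1 + 2 / c) * ε / (2 * σ) * ‖ν₁ - ν₂‖) := by
        field_simp
      -- Here `c > 2` enters, as `(c + 2)/2 ≥ 2`.
      have h4 : 2 * (ε / c) / σ * ‖ν₁ - ν₂‖ ≤ (1 + 2 / c) * ε / (2 * σ) * ‖ν₁ - ν₂‖ := by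
        refine mul_le_mul_of_nonneg_right ?_ hδ
        have e2 : (1 + 2 / c) * ε / (2 * σ) = (c + 2) / 2 * (ε / c) / σ := by
          field_simp
        rw [e2]
        gcongr
        linarith
      rw [e1] at h
      linarith

theorem lipschitzRate_div_le {n : ℕ} {K : Set (E n)}
    (hcl : IsClosed K) (hcv : Convex ℝ K) {c L σ : ℝ} (hc : 2 < c) (hL : 7 * c ≤ L) (hσ : 0 < σ)
    (h : ENNReal.ofReal (2 * (14 * c + 4 * L / (c + 2)) * σ) ≤ lipschitzRate K c L σ) :
    lipschitzRate K c L σ / ENNReal.ofReal c ≤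
      ENNReal.ofReal (16 * L / (c + 2)) * worstRate K σ := by
  have hc0 : 0 < c := by linarith
  have hL0 : 0 < L := by linarith
  set B := 14 * c + 4 * L / (c + 2) with hB
  have hB0 : 0 < B := by positivity
  have key : ∀ ε ∈ lipschitzRadii K c L σ, B * σ ≤ ε → ENNReal.ofReal ε ≤
      ENNReal.ofReal (16 * L / (c + 2)) * worstRate K σ * ENNReal.ofReal c := by
    intro ε hε hBε
    have h1 := le_worstRate_of_mem_lipschitzRadii hcl hcv hc hL hσ hε hBε
    calc ENNReal.ofReal ε = ENNReal.ofReal (16 * L / (c + 2)) *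
          ENNReal.ofReal ((c + 2) / (4 * L) * ε / (4 * c)) * ENNReal.ofReal c := by
          have := hε.1
          rw [← ENNReal.ofReal_mul (by positivity), ← ENNReal.ofReal_mul (by positivity)]
          congr 1
          field_simp
          norm_num
      _ ≤ _ := by gcongr
  refine ENNReal.div_le_of_le_mul (iSup₂_le fun ε hε => ?_)
  rcases le_total (B * σ) ε with hle | hle
  · exact key ε hε hle
  -- The factor `2` in the hypothesis makes this strict, so some radius exceeds `Bσ` and dominates
  -- the small ones.
  · have h1 : ENNReal.ofReal (B * σ) < lipschitzRate K c L σ := by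
      refine lt_of_lt_of_le ?_ h
      have : 0 < B * σ := by positivity
      rw [ENNReal.ofReal_lt_ofReal_iff (by positivity)]
      linarith
    rw [lipschitzRate, lt_iSup_iff] at h1
    obtain ⟨ε', h1⟩ := h1
    rw [lt_iSup_iff] at h1
    obtain ⟨hε', h1⟩ := h1
    have h2 := (ENNReal.ofReal_lt_ofReal_iff hε'.1).1 h1
    exact (ENNReal.ofReal_le_ofReal (hle.trans h2.le)).trans (key ε' hε' h2.le)

/-! ### The two-point lower bound and the final assembly. -/

theorem min_le_worstRate {n : ℕ} {K : Set (E n)} (hcl : IsClosed K) (hcv : Convex ℝ K) {σ : ℝ}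
    (hσ : 0 < σ) :
    ENNReal.ofReal (1 / 16) * min (ENNReal.ofReal σ) (Metric.ediam K) ≤ worstRate K σ := by
  set m := min (ENNReal.ofReal σ) (Metric.ediam K) with hm
  have hmtop : m ≠ ⊤ := ne_top_of_le_ne_top ENNReal.ofReal_ne_top (min_le_left _ _)
  rcases eq_or_ne m 0 with h0 | h0
  · rw [h0, mul_zero]
    exact bot_le
  have hpos : 0 < m.toReal := ENNReal.toReal_pos h0 hmtop
  have hme : ENNReal.ofReal m.toReal = m := ENNReal.ofReal_toReal hmtop
  have hmσ : m.toReal ≤ σ := ENNReal.toReal_le_of_le_ofReal hσ.le (min_le_left _ _)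
  set δ := m.toReal / 4 with hδ
  have hδ0 : 0 < δ := by positivity
  obtain ⟨p, hp, q, hq, hpq⟩ := exists_norm_sub_eq hcv hδ0.le (by
    refine lt_of_lt_of_le ?_ (hme.trans_le (min_le_right _ _))
    rw [ENNReal.ofReal_lt_ofReal_iff hpos]
    linarith : ENNReal.ofReal δ < Metric.ediam K)
  have hne : p ≠ q := by
    rintro rfl
    rw [sub_self, norm_zero] at hpq
    exact hδ0.ne hpq
  have key := le_worstRate_of_packing hcl hcv (η := δ / 2) (ρ := δ) (q := 3 / 4)
    (a := 1 / 2) hσ (by norm_num) (by norm_num) (by norm_num) (θ := p) (S := {p, q})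
    ⟨p, by simp⟩ (by simp [Set.insert_subset_iff, hp, hq]) ?_ ?_ ?_
  · refine le_trans (le_of_eq ?_) key
    rw [← hme, ← ENNReal.ofReal_mul (by norm_num)]
    congr 1
    rw [hδ]
    ring
  · intro a ha b hb hab
    simp only [Finset.mem_insert, Finset.mem_singleton] at ha hb
    rcases ha with rfl | rfl <;> rcases hb with rfl | rfl
    · exact absurd rfl hab
    · rw [hpq]; linarith
    · rw [norm_sub_rev, hpq]; linarith
    · exact absurd rfl hab
  · intro a ha
    simp only [Finset.mem_insert, Finset.mem_singleton] at ha
    rcases ha with rfl | rfl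
    · simpa using hδ0.le
    · rw [norm_sub_rev, hpq]
  · rw [Finset.card_pair hne]
    have h1 : δ / σ ≤ 1 / 4 := by rw [div_le_iff₀ hσ]; linarith
    have h2 : (δ / σ) ^ 2 ≤ (1 / 4) ^ 2 := by gcongr
    have h3 := Real.exp_bound_div_one_sub_of_interval (x := (1 / 4) ^ 2) (by norm_num) (by norm_num)
    have h4 := Real.exp_le_exp.2 h2
    refine h4.trans (h3.trans ?_)
    norm_num

end LSE

theorem theorem2p17 :
    ∀ c : ℝ, 2 < c → ∃ L₀ : ℝ, 0 < L₀ ∧ ∀ L : ℝ, L₀ ≤ L →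
      -- upper bound for the worst case rate
      (∃ A : ℝ≥0, 0 < A ∧
        ∀ (n : ℕ) (K : Set (LSE.E n)), K.Nonempty → IsClosed K → Convex ℝ K →
          ∀ σ : ℝ, 0 < σ →
            LSE.worstRate K σ ≤ A * LSE.lipschitzRate K c L (LSE.rescaledNoise c σ)) ∧
      -- lower bound, if the Lipschitz rate is at least a large multiple of the noise level
      (∃ A B : ℝ≥0, 0 < A ∧ 0 < B ∧
        ∀ (n : ℕ) (K : Set (LSE.E n)), K.Nonempty → IsClosed K → Convex ℝ K →
          ∀ σ : ℝ, 0 < σ →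
            B * ENNReal.ofReal σ ≤ LSE.lipschitzRate K c L σ →
            LSE.lipschitzRate K c L σ / ENNReal.ofReal c ≤ A * LSE.worstRate K σ) ∧
      -- the remaining regime
      (∀ D : ℝ≥0, ∃ a b : ℝ≥0, 0 < a ∧ 0 < b ∧
        ∀ (n : ℕ) (K : Set (LSE.E n)), K.Nonempty → IsClosed K → Convex ℝ K →
          ∀ σ : ℝ, 0 < σ →
            LSE.lipschitzRate K c L (LSE.rescaledNoise c σ) ≤ D * ENNReal.ofReal σ →
            a * min (ENNReal.ofReal σ) (Metric.ediam K) ≤ LSE.worstRate K σ ∧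
              LSE.worstRate K σ ≤ b * min (ENNReal.ofReal σ) (Metric.ediam K)) := by
  intro c hc
  refine ⟨7 * c, by linarith, fun L hL => ⟨?_, ?_, ?_⟩⟩
  · refine ⟨10000, by norm_num, fun n K hne hcl hcv σ hσ => ?_⟩
    exact_mod_cast LSE.worstRate_le_mul_lipschitzRate hne hcl hcv hc hL hσ
  · have hc0 : 0 < c := by linarith
    have hL0 : 0 < L := by linarith
    refine ⟨(16 * L / (c + 2)).toNNReal, (2 * (14 * c + 4 * L / (c + 2))).toNNReal,
      Real.toNNReal_pos.2 (by positivity), Real.toNNReal_pos.2 (by positivity),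
      fun n K _ hcl hcv σ hσ h => LSE.lipschitzRate_div_le hcl hcv hc hL hσ ?_⟩
    rw [ENNReal.ofReal_mul (by positivity)]
    exact h
  · intro D
    -- The term `10000 * D` serves the bound by `σ`, and `1` the bound by the diameter.
    refine ⟨(1 / 16 : ℝ).toNNReal, 10000 * D + 1, Real.toNNReal_pos.2 (by norm_num), by positivity,
      fun n K hne hcl hcv σ hσ h => ⟨LSE.min_le_worstRate hcl hcv hσ, ?_⟩⟩
    rw [mul_min, le_min_iff]
    constructor
    · refine (LSE.worstRate_le_mul_lipschitzRate hne hcl hcv hc hL hσ).trans ?_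
      calc 10000 * LSE.lipschitzRate K c L (LSE.rescaledNoise c σ)
          ≤ 10000 * (D * ENNReal.ofReal σ) := by gcongr
        _ = ((10000 * D : ℝ≥0) : ℝ≥0∞) * ENNReal.ofReal σ := by push_cast; ring
        _ ≤ _ := by gcongr; exact le_self_add
    · refine (LSE.worstRate_le_ediam hne hcl hcv σ).trans (le_mul_of_one_le_left' ?_)
      exact_mod_cast (le_add_self : (1 : ℝ≥0) ≤ 10000 * D + 1)
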